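/- Let $\Gamma$ be a countable discrete group. A trace on $\Gamma$ is a positive definite, conjugation-invariant function $\varphi:\Gamma\to\mathbb{C}$ with $\varphi(e)=1$. Let $\mathrm{Tr}(\Gamma)$ be the convex set of all traces, with the topology of pointwise convergence (classically, it is a metrizable Choquet simplex), and let the set $\mathrm{Ch}(\Gamma)$ of characters be the set of its extreme points. For a trace $\varphi$ let $\pi_\varphi$ be its GNS representation. Let $\mathcal{R}$ be a set of equivalence classes of unitary representations of $\Gamma$ that is hereditary, meaning that 1. if $\rho\in\mathcal{R}$ and $\pi$ is a subrepresentation of $\rho$, then $\pi\in\mathcal{R}$; 2. if $\rho\in\mathcal{R}$, then the dual representation $\rho^*$ is in $\mathcal{R}$; 3. if $\Pi$ is a unitary representation of $\Gamma\times\Gamma$ whose restrictions to both factors are in $\mathcal{R}$, then the restriction of $\Pi$ to the diagonal copy of $\Gamma$ is in $\mathcal{R}$. For $\pi\in\mathcal{R}$ let $\pi_0$ be the subrepresentation on the orthogonal complement of the invariant vectors. Suppose that $\Gamma$ has property $\mathrm{T}(\mathcal{R})$: the trivial representation $1$ is an isolated point of $\{\pi_0:\pi\in\mathcal{R}\}\cup\{1\}$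 in the Fell topology. Put $\mathrm{Ch}(\Gamma;\mathcal{R})=\{\varphi\in\mathrm{Ch}(\Gamma):\pi_\varphi\in\mathcal{R}\}$. Then $$\overline{\mathrm{Ch}(\Gamma;\mathcal{R})}\subset\mathrm{Ch}(\Gamma),$$ and the closed convex hull $\overline{\mathrm{conv}\,\mathrm{Ch}(\Gamma;\mathcal{R})}$ is a closed face of $\mathrm{Tr}(\Gamma)$ and is a Bauer simplex. In particular, if $\Gamma$ has Kazhdan's property (T), then $\mathrm{Tr}(\Gamma)$ is a Bauer simplex. Here a metrizable compact convex set is a Choquet simplex if each of its points is the barycenter of a unique Borel probability measure carried by its extreme points, and a Bauer simplex if moreover its set of extreme points is closed. (The empty set counts as a face and as a Bauer simplex; it occurs when $\mathrm{Ch}(\Gamma;\mathcal{R})=\emptyset$.) -/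

import Mathlib

universe u

noncomputable section

/-! ### Traces and characters of a group -/

section Traces

open scoped ComplexOrder ComplexConjugate

/-- A trace on a group: a positive definite, conjugation-invariant, normalized function.
(The order on `ℂ` is the usual one: `0 ≤ z` means that `z` is real and nonnegative.) -/
structure IsTrace {Γ : Type u} [Group Γ] (φ : Γ → ℂ) : Prop where
  posDef : ∀ (n : ℕ) (γ : Fin n → Γ) (α : Fin n → ℂ),
    0 ≤ ∑ i, ∑ j, α i * conj (α j) * φ ((γ j)⁻¹ * γ i)
  conj_inv : ∀ γ x : Γ, φ (x⁻¹ * γ * x) = φ γ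
  map_one : φ 1 = 1

/-- `Tr(Γ)`, as a subset of the locally convex space `Γ → ℂ`, whose topology is the topology of
pointwise convergence. -/
def traces (Γ : Type u) [Group Γ] : Set (Γ → ℂ) := {φ | IsTrace φ}

/-- `Ch(Γ)`: the extreme points of `Tr(Γ)`. -/
def characters (Γ : Type u) [Group Γ] : Set (Γ → ℂ) := Set.extremePoints ℝ (traces Γ)

theorem IsTrace.map_inv {Γ : Type u} [Group Γ] {φ : Γ → ℂ} (h : IsTrace φ) (g : Γ) :
    φ g⁻¹ = conj (φ g) := by
  have h1 := (Complex.le_def.1 (h.posDef 2 ![1, g] ![1, 1])).2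
  have h2 := (Complex.le_def.1 (h.posDef 2 ![1, g] ![1, Complex.I])).2
  simp [Fin.sum_univ_two, h.map_one] at h1 h2
  apply Complex.ext
  · simp; linarith
  · simp; linarith

theorem IsTrace.finsupp_nonneg {Γ : Type u} [Group Γ] {φ : Γ → ℂ} (h : IsTrace φ) (f : Γ →₀ ℂ) :
    0 ≤ f.sum fun x a => f.sum fun y b => conj a * b * φ (x⁻¹ * y) := by
  have e := f.support.equivFin.symm
  have key := h.posDef _ (fun i => (e i : Γ)) (fun i => f (e i))
  rw [Finset.sum_comm] at key
  simp only [Finsupp.sum]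
  rw [← Finset.sum_coe_sort f.support, ← e.sum_comp]
  convert key using 2 with j
  rw [← Finset.sum_coe_sort f.support, ← e.sum_comp]
  refine Finset.sum_congr rfl fun i _ => ?_
  ring

end Traces

/-! ### Unitary representations of discrete groups -/

/-- A unitary representation of the (discrete) group `G`: a Hilbert space `space` and a homomorphism
into its unitary group. -/
structure UnitaryRep (G : Type u) [Group G] where
  space : Type u
  [instNormed : NormedAddCommGroup space]
  [instInner : InnerProductSpace ℂ space]
  [instComplete : CompleteSpace space]
  hom : G →* (space ≃ₗᵢ[ℂ] space)

attribute [instance] UnitaryRep.instNormed UnitaryRep.instInner UnitaryRep.instComplete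

namespace UnitaryRep

variable {G : Type u} [Group G]

/-- Unitary equivalence. -/
def Equivalent (π ρ : UnitaryRep G) : Prop :=
  ∃ T : π.space ≃ₗᵢ[ℂ] ρ.space, ∀ g v, T (π.hom g v) = ρ.hom g (T v)

/-- `π ≤ ρ`: `π` is equivalent to a subrepresentation of `ρ`. -/
def IsContainedIn (π ρ : UnitaryRep G) : Prop :=
  ∃ T : π.space →ₗᵢ[ℂ] ρ.space, ∀ g v, T (π.hom g v) = ρ.hom g (T v)

/-- `σ` is (a model of) the dual representation `π*` of `π`, that is, the representation induced
by `π` on the dual Hilbert space, which is the conjugate of the Hilbert space of `π` by the Riesz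
representation theorem: `σ` is intertwined with `π` by a surjective conjugate-linear isometry.
This determines `σ` up to unitary equivalence. -/
def IsDualOf (σ π : UnitaryRep G) : Prop :=
  ∃ J : π.space ≃ₗᵢ⋆[ℂ] σ.space, ∀ g v, J (π.hom g v) = σ.hom g (J v)

/-- The pullback of a unitary representation along a group homomorphism. -/
def comap {K : Type u} [Group K] (π : UnitaryRep G) (f : K →* G) : UnitaryRep K where
  space := π.space
  hom := π.hom.comp f

/-- The trivial (one-dimensional) representation `1`. -/
def trivial (G : Type u) [Group G] : UnitaryRep G where
  space := EuclideanSpace ℂ PUnit.{u + 1}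
  hom := 1

/-- The closed subspace of invariant vectors. -/
def invariants (π : UnitaryRep G) : Submodule ℂ π.space where
  carrier := {v | ∀ g, π.hom g v = v}
  add_mem' := fun hv hw g => by rw [map_add, hv g, hw g]
  zero_mem' := fun g => map_zero _
  smul_mem' := fun c v hv g => by rw [map_smul, hv g]

theorem hom_mem_invariants_orthogonal (π : UnitaryRep G) (g : G) {v : π.space}
    (hv : v ∈ π.invariantsᗮ) : π.hom g v ∈ π.invariantsᗮ := by
  rw [Submodule.mem_orthogonal] at hv ⊢
  intro w hw
  rw [← hw g, LinearIsometryEquiv.inner_map_map]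
  exact hv w hw

/-- `π₀`: the subrepresentation of `π` on the orthogonal complement of the invariant vectors. -/
def withoutInvariants (π : UnitaryRep G) : UnitaryRep G where
  space := π.invariantsᗮ
  hom :=
    { toFun := fun g =>
        { toFun := fun v => ⟨π.hom g v, π.hom_mem_invariants_orthogonal g v.2⟩
          invFun := fun v => ⟨π.hom g⁻¹ v, π.hom_mem_invariants_orthogonal g⁻¹ v.2⟩
          map_add' := fun v w => Subtype.ext (map_add (π.hom g) _ _)
          map_smul' := fun c v => Subtype.ext (map_smul (π.hom g) _ _)
          left_inv := fun v => Subtype.ext (by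
            change (π.hom g⁻¹ * π.hom g) (v : π.space) = v
            rw [← map_mul, inv_mul_cancel, map_one]; rfl)
          right_inv := fun v => Subtype.ext (by
            change (π.hom g * π.hom g⁻¹) (v : π.space) = v
            rw [← map_mul, mul_inv_cancel, map_one]; rfl)
          norm_map' := fun v => (π.hom g).norm_map (v : π.space) }
      map_one' := by
        ext v
        change (π.hom 1) (v : π.space) = v
        rw [map_one]; rfl
      map_mul' := fun g h => by
        ext v
        change (π.hom (g * h)) (v : π.space) = π.hom g (π.hom h v)
        rw [map_mul]; rfl }

/-- The set of all representations `ρ` having a finite sum of functions of positive type associated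
to `ρ` which is `ε`-close, on the finite set `Q`, to the function of positive type
`g ↦ ⟨π(g)ξ, ξ⟩` associated to `π`. (Mathlib's inner product is conjugate-linear in its first
argument.) -/
def fellNhd (π : UnitaryRep G) (ξ : π.space) (Q : Finset G) (ε : ℝ) : Set (UnitaryRep G) :=
  {ρ | ∃ (n : ℕ) (η : Fin n → ρ.space), ∀ g ∈ Q,
    ‖inner ℂ ξ (π.hom g ξ) - ∑ k, inner ℂ (η k) (ρ.hom g (η k))‖ < ε}

/-- The Fell topology on unitary representations of the discrete group `G`. The finite
intersections of the sets `fellNhd π ξ Q ε`, with `π` fixed, form a basis of neighbourhoods of `π`.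
These sets are saturated for unitary equivalence, so this is the pullback of the Fell topology on
equivalence classes. -/
instance fellTopology : TopologicalSpace (UnitaryRep G) :=
  TopologicalSpace.generateFrom
    {U | ∃ (π : UnitaryRep G) (ξ : π.space) (Q : Finset G) (ε : ℝ), 0 < ε ∧ U = fellNhd π ξ Q ε}

/-- A set `R` of unitary representations is hereditary. A set of equivalence classes is represented
by the set of all members of its classes; invariance of `R` under equivalence is part of closedness
under subrepresentations, since `IsContainedIn` is containment up to equivalence. -/
structure IsHereditary {Γ : Type u} [Group Γ] (R : Set (UnitaryRep Γ)) : Prop where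
  subrep_closed : ∀ ρ ∈ R, ∀ π : UnitaryRep Γ, π.IsContainedIn ρ → π ∈ R
  dual_closed : ∀ ρ ∈ R, ∀ σ : UnitaryRep Γ, σ.IsDualOf ρ → σ ∈ R
  diagonal_closed : ∀ P : UnitaryRep (Γ × Γ),
    P.comap (MonoidHom.inl Γ Γ) ∈ R → P.comap (MonoidHom.inr Γ Γ) ∈ R →
      P.comap ((MonoidHom.id Γ).prod (MonoidHom.id Γ)) ∈ R

end UnitaryRep

/-- Property `T(R)`: up to equivalence, the trivial representation is an isolated point of the set
`{π₀ : π ∈ R} ∪ {1}` in the Fell topology. -/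
def HasPropertyTRel {Γ : Type u} [Group Γ] (R : Set (UnitaryRep Γ)) : Prop :=
  ∃ U : Set (UnitaryRep Γ), IsOpen U ∧ UnitaryRep.trivial Γ ∈ U ∧
    ∀ π ∈ R, π.withoutInvariants ∈ U → π.withoutInvariants.Equivalent (UnitaryRep.trivial Γ)

/-- Kazhdan's property (T), for a discrete group: there is a Kazhdan pair `(Q, ε)`. -/
def HasPropertyT (Γ : Type u) [Group Γ] : Prop :=
  ∃ (Q : Finset Γ) (ε : ℝ), 0 < ε ∧ ∀ π : UnitaryRep Γ,
    (∃ ξ : π.space, ξ ≠ 0 ∧ ∀ g ∈ Q, ‖π.hom g ξ - ξ‖ < ε * ‖ξ‖) →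
      ∃ η : π.space, η ≠ 0 ∧ ∀ g, π.hom g η = η

/-! ### The GNS representation of a trace -/

namespace GNS

open scoped ComplexConjugate

variable {Γ : Type u} [Group Γ] {φ : Γ → ℂ}

/-- The space of finitely supported functions on `Γ`, to be equipped with the positive semidefinite
sesquilinear form `⟨δ_x, δ_y⟩ = φ(x⁻¹y)` (conjugate-linear in the first variable). -/
@[nolint unusedArguments]
def PreSpace (_h : IsTrace φ) : Type u := Γ →₀ ℂ

instance (h : IsTrace φ) : AddCommGroup (PreSpace h) := inferInstanceAs (AddCommGroup (Γ →₀ ℂ))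
instance (h : IsTrace φ) : Module ℂ (PreSpace h) := inferInstanceAs (Module ℂ (Γ →₀ ℂ))

def form (φ : Γ → ℂ) (f g : Γ →₀ ℂ) : ℂ :=
  f.sum fun x a => g.sum fun y b => conj a * b * φ (x⁻¹ * y)

theorem form_conj_symm (h : IsTrace φ) (f g : Γ →₀ ℂ) : conj (form φ g f) = form φ f g := by
  simp only [form, Finsupp.sum, map_sum, map_mul, Complex.conj_conj]
  rw [Finset.sum_comm]
  refine Finset.sum_congr rfl fun x _ => Finset.sum_congr rfl fun y _ => ?_
  rw [← h.map_inv, mul_inv_rev, inv_inv]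
  ring

theorem form_add_left (f₁ f₂ g : Γ →₀ ℂ) : form φ (f₁ + f₂) g = form φ f₁ g + form φ f₂ g := by
  unfold form
  rw [Finsupp.sum_add_index']
  · intro x; simp
  · intro x a b
    simp [Finsupp.sum, add_mul, Finset.sum_add_distrib]

theorem form_smul_left (c : ℂ) (f g : Γ →₀ ℂ) : form φ (c • f) g = conj c * form φ f g := by
  unfold form
  rw [Finsupp.sum_smul_index']
  · simp [Finsupp.sum, Finset.mul_sum, mul_assoc]
  · intro x; simp

/-- Left translation of finitely supported functions, `δ_x ↦ δ_{γx}`. -/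
def shift (γ : Γ) : (Γ →₀ ℂ) ≃ₗ[ℂ] (Γ →₀ ℂ) := Finsupp.domLCongr (Equiv.mulLeft γ)

theorem form_shift (γ : Γ) (f g : Γ →₀ ℂ) : form φ (shift γ f) (shift γ g) = form φ f g := by
  simp only [form, shift, Finsupp.domLCongr_apply, Finsupp.domCongr_apply,
    Finsupp.equivMapDomain_eq_mapDomain]
  rw [Finsupp.sum_mapDomain_index_inj (Equiv.injective _)]
  refine Finsupp.sum_congr fun x _ => ?_
  rw [Finsupp.sum_mapDomain_index_inj (Equiv.injective _)]
  refine Finsupp.sum_congr fun y _ => ?_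
  simp [mul_assoc]

theorem shift_mul (γ δ : Γ) (f : Γ →₀ ℂ) : shift (γ * δ) f = shift γ (shift δ f) := by
  ext x
  simp [shift, Finsupp.domLCongr_apply, Finsupp.domCongr_apply, mul_assoc, -Equiv.mulLeft_mul]

theorem shift_one (f : Γ →₀ ℂ) : shift 1 f = f := by
  ext x
  simp [shift, Finsupp.domLCongr_apply, Finsupp.domCongr_apply, -Equiv.mulLeft_one]

abbrev core (h : IsTrace φ) : PreInnerProductSpace.Core ℂ (PreSpace h) where
  inner f g := form φ f g
  conj_inner_symm f g := form_conj_symm h f g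
  re_inner_nonneg f := (Complex.le_def.1 (h.finsupp_nonneg f)).1
  add_left f₁ f₂ g := form_add_left f₁ f₂ g
  smul_left f g c := form_smul_left c f g

instance (h : IsTrace φ) : SeminormedAddCommGroup (PreSpace h) :=
  InnerProductSpace.Core.toSeminormedAddCommGroup (c := core h)
instance (h : IsTrace φ) : InnerProductSpace ℂ (PreSpace h) := InnerProductSpace.ofCore (core h)

theorem inner_def (h : IsTrace φ) (f g : PreSpace h) : inner ℂ f g = form φ f g := rfl

/-- Left translation as an isometry of the pre-Hilbert space. -/
def preTranslation (h : IsTrace φ) (γ : Γ) : PreSpace h →ₗᵢ[ℂ] PreSpace h where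
  toLinearMap := (shift γ).toLinearMap
  norm_map' f := by
    rw [@norm_eq_sqrt_re_inner ℂ, @norm_eq_sqrt_re_inner ℂ _ _ _ _ f, inner_def, inner_def]
    exact congrArg (fun z => √(RCLike.re z)) (form_shift γ f f)

/-- The isometry of the (Hausdorff) completion induced by left translation. -/
def translation (h : IsTrace φ) (γ : Γ) :
    UniformSpace.Completion (PreSpace h) →L[ℂ] UniformSpace.Completion (PreSpace h) :=
  (preTranslation h γ).toContinuousLinearMap.completion

theorem translation_coe (h : IsTrace φ) (γ : Γ) (f : PreSpace h) :
    translation h γ (f : UniformSpace.Completion (PreSpace h)) = (preTranslation h γ f : PreSpace h) :=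
  ContinuousLinearMap.completion_apply_coe _ _

theorem translation_mul (h : IsTrace φ) (γ δ : Γ) (v : UniformSpace.Completion (PreSpace h)) :
    translation h (γ * δ) v = translation h γ (translation h δ v) := by
  induction v using UniformSpace.Completion.induction_on with
  | hp => exact isClosed_eq (by fun_prop) (by fun_prop)
  | ih f =>
    simp only [translation_coe]
    congr 1
    exact shift_mul γ δ f

theorem translation_one (h : IsTrace φ) (v : UniformSpace.Completion (PreSpace h)) :
    translation h 1 v = v := by
  induction v using UniformSpace.Completion.induction_on with
  | hp => exact isClosed_eq (by fun_prop) (by fun_prop)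
  | ih f =>
    simp only [translation_coe]
    congr 1
    exact shift_one f

theorem norm_translation (h : IsTrace φ) (γ : Γ) (v : UniformSpace.Completion (PreSpace h)) :
    ‖translation h γ v‖ = ‖v‖ := by
  induction v using UniformSpace.Completion.induction_on with
  | hp => exact isClosed_eq (by fun_prop) (by fun_prop)
  | ih f =>
    rw [translation_coe, UniformSpace.Completion.norm_coe, UniformSpace.Completion.norm_coe]
    exact (preTranslation h γ).norm_map f

end GNS

/-- The representation `π_φ` of the GNS construction for the trace `φ`: left translation on the
Hilbert space completion of the finitely supported functions with respect to
`⟨δ_x, δ_y⟩ = φ(x⁻¹y)`. The cyclic vector is the class of `δ_1`. -/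
def gnsRep {Γ : Type u} [Group Γ] (φ : Γ → ℂ) (h : IsTrace φ) : UnitaryRep Γ where
  space := UniformSpace.Completion (GNS.PreSpace h)
  hom :=
    { toFun := fun γ =>
        { toLinearMap := (GNS.translation h γ).toLinearMap
          invFun := GNS.translation h γ⁻¹
          left_inv := fun v => by
            change GNS.translation h γ⁻¹ (GNS.translation h γ v) = v
            rw [← GNS.translation_mul, inv_mul_cancel, GNS.translation_one]
          right_inv := fun v => by
            change GNS.translation h γ (GNS.translation h γ⁻¹ v) = v
            rw [← GNS.translation_mul, mul_inv_cancel, GNS.translation_one]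
          norm_map' := GNS.norm_translation h γ }
      map_one' := by
        ext v
        exact GNS.translation_one h v
      map_mul' := fun γ δ => by
        ext v
        exact GNS.translation_mul h γ δ v }

/-- `Ch(Γ; R)`: the characters whose GNS representation belongs to `R`. -/
def charactersIn {Γ : Type u} [Group Γ] (R : Set (UnitaryRep Γ)) : Set (Γ → ℂ) :=
  {φ | φ ∈ characters Γ ∧ ∃ h : IsTrace φ, gnsRep φ h ∈ R}

/-! ### Faces and simplices -/

/-- A closed face `F` of a convex set `S`. -/
structure IsClosedFace {E : Type*} [AddCommGroup E] [Module ℝ E] [TopologicalSpace E]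
    (S F : Set E) : Prop where
  isClosed : IsClosed F
  convex : Convex ℝ F
  isExtreme : IsExtreme ℝ S F

/-- A (metrizable) Choquet simplex: a metrizable compact convex set each of whose points is the
barycenter of a unique Borel probability measure carried by the set of extreme points. -/
structure IsChoquetSimplex {E : Type*} [AddCommGroup E] [Module ℝ E] [TopologicalSpace E]
    [MeasurableSpace E] [BorelSpace E] (K : Set E) : Prop where
  isCompact : IsCompact K
  metrizable : TopologicalSpace.MetrizableSpace K
  convex : Convex ℝ K
  existsUnique_measure : ∀ x ∈ K, ∃! μ : MeasureTheory.Measure E,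
    MeasureTheory.IsProbabilityMeasure μ ∧ μ (Set.extremePoints ℝ K)ᶜ = 0 ∧
      ∀ f : E →L[ℝ] ℝ, ∫ y, f y ∂μ = f x

/-- A Bauer simplex: a Choquet simplex whose set of extreme points is closed. -/
structure IsBauerSimplex {E : Type*} [AddCommGroup E] [Module ℝ E] [TopologicalSpace E]
    [MeasurableSpace E] [BorelSpace E] (K : Set E) : Prop where
  isChoquetSimplex : IsChoquetSimplex K
  isClosed_extremePoints : IsClosed (Set.extremePoints ℝ K)

end

/-!
The idea is that, for a hereditary set `R` with property `T(R)`, averaging over conjugations is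
uniformly contracting on the GNS spaces of all characters in `R` at once. This makes the values of
these characters on the group ring asymptotically multiplicative, and everything else is soft.

*The spectral gap.* Let `χ` be a character with `π_χ ∈ R`. Left and right translations turn the GNS
space into a representation of `Γ × Γ` (`biRep`). Its restriction to the first factor is `π_χ`, and
the modular conjugation `f ↦ f*` identifies the restriction to the second factor with the dual of
`π_χ`; hence the representation of `Γ` by conjugations belongs to `R`. Since `χ` is extreme, the only
invariant vectors of the latter are the multiples of the cyclic vector (`exists_eq_smul_δ`): the
closed graph of the operator `x ↦ x v`, for `v` invariant, is stable under left translations and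
conjugations, and extremality forces the operators commuting with all of these to act on the cyclic
vector as scalars. Property `T(R)` provides a Kazhdan pair `(Q, ε)` for `R`, so averaging over the
conjugations by `Q` and the identity contracts the orthogonal complement of the constants by a
factor which does not depend on `χ`. Iterated averages `f'` of an element `f` of the group ring have
the same value as `f` at every trace, and they converge to the constant `χ(f)` uniformly in `χ`: the
set `Ch(Γ; R)` is uniformly centred (`IsUniformlyCentred`, `isUniformlyCentred_charactersIn`).

*Consequences.* Being uniformly centred passes to the closure `X`, and it implies that the members of
`X` are extreme: a trace `ψ` dominated by a multiple of `χ ∈ X` satisfies `ψ(f) = ψ(f') ≈ χ(f)`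
(`IsUniformlyCentred.subset_characters`). Moreover `χ(f'* f')` converges to `|χ(f)|²` uniformly on
`X`, so that the uniform closure of the functions `χ ↦ Re χ(f)` in `C(X, ℝ)` is an algebra, and by
the Stone–Weierstrass theorem it is everything (`IsUniformlyCentred.denseRange`); nonnegative
functions are limits of functions `χ ↦ χ(a* a)`. Density gives the uniqueness of representing
measures on `X`. If a trace `ψ` is dominated by a multiple of a point of the closed convex hull
`K` of `X`, then `|ψ(f)|² = |ψ(f')|² ≤ ψ(f'* f')` shows that `ψ` is bounded for the supremum norm over
`X`. So it extends to a functional on `C(X, ℝ)`, which is positive because `ψ(a* a) ≥ 0`, and the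
Riesz–Markov–Kakutani theorem represents `ψ` by a probability measure on `X`
(`IsUniformlyCentred.exists_measure`). For `ψ ∈ K` this is the existence of representing measures; for
the ends `ψ` of a segment of traces meeting `K` it shows that `ψ ∈ K`, that is, that `K` is a face.

For a group with property (T), the set of all representations is hereditary and has a Kazhdan pair,
and the closed convex hull of the set of all characters is `Tr(Γ)` by the Krein–Milman theorem.
-/

noncomputable section

namespace GroupTrace

open MeasureTheory
open scoped ComplexOrder ComplexConjugate

/-! ### The group ring and the GNS seminorms -/

section GroupRing

variable {Γ : Type u}

/-- The linear extension of a function `φ` on `Γ` to the group ring, whose elements are regarded as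
finitely supported functions. -/
def ev (φ : Γ → ℂ) : (Γ →₀ ℂ) →ₗ[ℂ] ℂ := Finsupp.linearCombination ℂ φ

theorem ev_apply (φ : Γ → ℂ) (f : Γ →₀ ℂ) : ev φ f = f.sum fun g a => a * φ g := by
  simp [ev, Finsupp.linearCombination_apply]

theorem ev_single (φ : Γ → ℂ) (g : Γ) (a : ℂ) : ev φ (Finsupp.single g a) = a * φ g := by
  simp [ev]

theorem continuous_ev (f : Γ →₀ ℂ) : Continuous fun φ : Γ → ℂ => ev φ f := by
  simp only [ev_apply, Finsupp.sum]
  fun_prop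

/-- The real-linear functional `φ ↦ Re φ(f)`. -/
def reEv (f : Γ →₀ ℂ) : (Γ → ℂ) →L[ℝ] ℝ where
  toFun φ := (ev φ f).re
  map_add' φ ψ := by
    simp [ev_apply, Finsupp.sum, mul_add, Finset.sum_add_distrib]
  map_smul' c φ := by
    simp only [ev_apply, Finsupp.sum, Pi.smul_apply, RingHom.id_apply, Complex.real_smul,
      smul_eq_mul, Complex.re_sum, Finset.mul_sum]
    refine Finset.sum_congr rfl fun g _ => ?_
    rw [← Complex.re_ofReal_mul]
    ring_nf
  cont := Complex.continuous_re.comp (continuous_ev f)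

theorem reEv_apply (f : Γ →₀ ℂ) (φ : Γ → ℂ) : reEv f φ = (ev φ f).re := rfl

/-- The group ring as functions on a set of traces, `f ↦ (χ ↦ Re χ(f))`. -/
def toContinuousMap (X : Set (Γ → ℂ)) : (Γ →₀ ℂ) →ₗ[ℝ] C(X, ℝ) where
  toFun f := ⟨fun χ => reEv f χ, (reEv f).continuous.comp continuous_subtype_val⟩
  map_add' f g := by ext χ; simp [reEv_apply]
  map_smul' c f := by ext χ; simp [reEv_apply]

theorem toContinuousMap_apply {X : Set (Γ → ℂ)} (f : Γ →₀ ℂ) (χ : X) :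
    toContinuousMap X f χ = reEv f χ := rfl

/-- Every continuous functional for the topology of pointwise convergence comes from the group
ring: it depends on finitely many coordinates only. -/
theorem exists_reEv_eq (F : (Γ → ℂ) →L[ℝ] ℝ) : ∃ f : Γ →₀ ℂ, F = reEv f := by
  classical
  have h0 : F ⁻¹' Metric.ball 0 1 ∈ nhds (0 : Γ → ℂ) :=
    F.continuous.continuousAt.preimage_mem_nhds (by simpa using Metric.ball_mem_nhds (0 : ℝ) one_pos)
  rw [nhds_pi, Filter.mem_pi] at h0
  obtain ⟨I, hI, t, ht, hsub⟩ := h0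
  -- `F` is bounded on the subspace of functions vanishing on `I`, hence zero there
  have hvan : ∀ φ : Γ → ℂ, (∀ g ∈ I, φ g = 0) → F φ = 0 := by
    intro φ hφ
    by_contra hne
    have hmem : (F φ)⁻¹ • φ ∈ F ⁻¹' Metric.ball 0 1 := by
      apply hsub
      intro g hg
      simp only [Pi.smul_apply, hφ g hg, smul_zero]
      exact mem_of_mem_nhds (ht g)
    simp [hne] at hmem
  -- the coefficient for which `F` is `z ↦ Re (a g * z)` on the coordinate `g`
  let a : Γ → ℂ := fun g => (F (Pi.single g 1) : ℂ) - (F (Pi.single g Complex.I) : ℂ) * Complex.I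
  have ha : ∀ g z, F (Pi.single g z) = (a g * z).re := by
    intro g z
    have : (Pi.single g z : Γ → ℂ) =
        z.re • (Pi.single g 1 : Γ → ℂ) + z.im • (Pi.single g Complex.I : Γ → ℂ) := by
      rw [← Pi.single_smul, ← Pi.single_smul, ← Pi.single_add]
      congr 1
      apply Complex.ext <;> simp
    rw [this, map_add, map_smul, map_smul]
    simp [a]
    ring
  refine ⟨∑ g ∈ hI.toFinset, Finsupp.single g (a g), ContinuousLinearMap.ext fun φ => ?_⟩
  have h1 : F (φ - ∑ g ∈ hI.toFinset, Pi.single g (φ g)) = 0 := by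
    apply hvan
    intro g hg
    simp [Finset.sum_apply, Pi.single_apply, hg]
  rw [map_sub, sub_eq_zero, map_sum] at h1
  rw [h1, reEv_apply, map_sum, Complex.re_sum]
  exact Finset.sum_congr rfl fun g _ => by rw [ha, ev_single]

variable [Group Γ] {φ : Γ → ℂ}

/-- The unit of the group ring. -/
def unit : Γ →₀ ℂ := Finsupp.single 1 1

/-- `φ(f* f)`, the square of the norm of `f` in the GNS space of a trace `φ`. -/
def sqNorm (φ : Γ → ℂ) (f : Γ →₀ ℂ) : ℝ := (GNS.form φ f f).re

theorem ev_unit (h : IsTrace φ) : ev φ unit = 1 := by simp [unit, ev_single, h.map_one]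

theorem form_unit_left (φ : Γ → ℂ) (f : Γ →₀ ℂ) : GNS.form φ unit f = ev φ f := by
  simp [GNS.form, unit, ev_apply]

/-- An element of the group ring, regarded as a vector of the pre-Hilbert space of a trace. -/
def toPre (h : IsTrace φ) : (Γ →₀ ℂ) →ₗ[ℂ] GNS.PreSpace h where
  toFun f := f
  map_add' _ _ := rfl
  map_smul' _ _ := rfl

theorem inner_toPre (h : IsTrace φ) (f g : Γ →₀ ℂ) :
    inner ℂ (toPre h f) (toPre h g) = GNS.form φ f g := rfl

theorem sqNorm_eq_norm_sq (h : IsTrace φ) (f : Γ →₀ ℂ) :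
    sqNorm φ f = ‖toPre h f‖ ^ 2 := by
  rw [← inner_self_eq_norm_sq (𝕜 := ℂ)]; rfl

theorem sqNorm_nonneg (h : IsTrace φ) (f : Γ →₀ ℂ) : 0 ≤ sqNorm φ f := by
  rw [sqNorm_eq_norm_sq h]; positivity

theorem norm_unit (h : IsTrace φ) : ‖toPre h unit‖ = 1 := by
  have h1 : ‖toPre h unit‖ ^ 2 = 1 := by
    rw [← sqNorm_eq_norm_sq h, sqNorm, form_unit_left, ev_unit h, Complex.one_re]
  nlinarith [norm_nonneg (toPre h unit)]

/-- The Cauchy–Schwarz inequality for a trace. -/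
theorem norm_ev_sq_le (h : IsTrace φ) (f : Γ →₀ ℂ) : ‖ev φ f‖ ^ 2 ≤ sqNorm φ f := by
  have h1 := norm_inner_le_norm (𝕜 := ℂ) (toPre h unit) (toPre h f)
  rw [norm_unit, one_mul, inner_toPre, form_unit_left] at h1
  rw [sqNorm_eq_norm_sq h]
  gcongr

/-- Pythagoras: `f - φ(f)` is orthogonal to the constants. -/
theorem sqNorm_sub_ev (h : IsTrace φ) (f : Γ →₀ ℂ) :
    sqNorm φ (f - ev φ f • unit) = sqNorm φ f - ‖ev φ f‖ ^ 2 := by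
  have h1 := @norm_sub_sq ℂ _ _ _ _ (toPre h f) (toPre h (ev φ f • unit))
  rw [map_smul, inner_smul_right, ← inner_conj_symm, inner_toPre, form_unit_left, norm_smul, norm_unit,
    mul_one, Complex.mul_conj, Complex.normSq_eq_norm_sq] at h1
  rw [sqNorm_eq_norm_sq h, sqNorm_eq_norm_sq h]
  rw [map_sub, map_smul]
  refine h1.trans ?_
  have : RCLike.re (((‖ev φ f‖ ^ 2 : ℝ) : ℂ)) = ‖ev φ f‖ ^ 2 := Complex.ofReal_re _
  rw [this]
  ring

/-- The element `f* f` of the group ring. -/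
def starSquare (f : Γ →₀ ℂ) : Γ →₀ ℂ :=
  f.sum fun x a => f.sum fun y b => Finsupp.single (x⁻¹ * y) (conj a * b)

theorem ev_starSquare (φ : Γ → ℂ) (f : Γ →₀ ℂ) : ev φ (starSquare f) = GNS.form φ f f := by
  simp only [starSquare, GNS.form, Finsupp.sum, map_sum, ev_single]

/-- The self-adjoint part `(f + f*)/2` of an element `f` of the group ring. -/
def selfAdjPart (f : Γ →₀ ℂ) : Γ →₀ ℂ :=
  (2⁻¹ : ℂ) • (f + f.sum fun g a => Finsupp.single g⁻¹ (conj a))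

theorem ev_selfAdjPart (h : IsTrace φ) (f : Γ →₀ ℂ) :
    ev φ (selfAdjPart f) = ((ev φ f).re : ℂ) := by
  have : ev φ (f.sum fun g a => Finsupp.single g⁻¹ (conj a)) = conj (ev φ f) := by
    rw [ev_apply φ f]
    simp only [Finsupp.sum, map_sum, ev_single, h.map_inv, map_mul]
  rw [selfAdjPart, map_smul, map_add, this, Complex.add_conj, smul_eq_mul]
  push_cast
  ring

theorem continuous_sqNorm (f : Γ →₀ ℂ) : Continuous fun φ : Γ → ℂ => sqNorm φ f := by
  simp only [sqNorm, ← ev_starSquare]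
  exact Complex.continuous_re.comp (continuous_ev _)

theorem reEv_starSquare (f : Γ →₀ ℂ) (φ : Γ → ℂ) : reEv (starSquare f) φ = sqNorm φ f := by
  rw [reEv_apply, ev_starSquare, sqNorm]

end GroupRing

/-! ### The set of traces -/

section Traces

variable {Γ : Type u} [Group Γ] {φ : Γ → ℂ}

theorem norm_apply_le_one (h : IsTrace φ) (g : Γ) : ‖φ g‖ ≤ 1 := by
  have h1 := norm_ev_sq_le h (Finsupp.single g 1)
  have h2 : sqNorm φ (Finsupp.single g 1) = 1 := by simp [sqNorm, GNS.form, h.map_one]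
  rw [h2, ev_single, one_mul] at h1
  nlinarith [norm_nonneg (φ g)]

theorem isClosed_traces : IsClosed (traces Γ) := by
  have : traces Γ = (⋂ (n : ℕ) (γ : Fin n → Γ) (α : Fin n → ℂ),
      {φ : Γ → ℂ | 0 ≤ ∑ i, ∑ j, α i * conj (α j) * φ ((γ j)⁻¹ * γ i)}) ∩
      ((⋂ (γ : Γ) (x : Γ), {φ : Γ → ℂ | φ (x⁻¹ * γ * x) = φ γ}) ∩ {φ | φ 1 = 1}) := by
    ext φ
    simp only [Set.mem_inter_iff, Set.mem_iInter, Set.mem_ofPred_eq]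
    exact ⟨fun h => ⟨h.posDef, h.conj_inv, h.map_one⟩, fun h => ⟨h.1, h.2.1, h.2.2⟩⟩
  rw [this]
  refine IsClosed.inter ?_ (IsClosed.inter ?_ ?_)
  · refine isClosed_iInter fun n => isClosed_iInter fun γ => isClosed_iInter fun α => ?_
    exact isClosed_le (by fun_prop) (by fun_prop)
  · exact isClosed_iInter fun γ => isClosed_iInter fun x => isClosed_eq (by fun_prop) (by fun_prop)
  · exact isClosed_eq (by fun_prop) (by fun_prop)

theorem isCompact_traces : IsCompact (traces Γ) :=
  (isCompact_univ_pi fun _ : Γ => isCompact_closedBall (0 : ℂ) 1).of_isClosed_subset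
    isClosed_traces fun φ (h : IsTrace φ) g _ => by simpa using norm_apply_le_one h g

theorem convex_traces : Convex ℝ (traces Γ) := by
  intro φ (hφ : IsTrace φ) ψ (hψ : IsTrace ψ) s t hs ht hst
  refine ⟨fun n γ α => ?_, fun γ x => ?_, ?_⟩
  · have h1 := add_nonneg (mul_nonneg (Complex.zero_le_real.2 hs) (hφ.posDef n γ α))
      (mul_nonneg (Complex.zero_le_real.2 ht) (hψ.posDef n γ α))
    simp only [Finset.mul_sum, ← Finset.sum_add_distrib] at h1
    convert h1 using 4
    simp
    ring
  · simp [hφ.conj_inv, hψ.conj_inv]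
  · simp only [Pi.add_apply, Pi.smul_apply, hφ.map_one, hψ.map_one, Complex.real_smul, mul_one]
    exact_mod_cast hst

end Traces

/-! ### Uniformly centred sets of traces -/

section Centred

variable {Γ : Type u} [Group Γ] {φ ψ : Γ → ℂ} {X : Set (Γ → ℂ)}

/-- A set `X` of traces is uniformly centred if every element `f` of the group ring can be replaced
by an element `f'` having the same value at every trace and which is, uniformly for `χ ∈ X`, almost
equal to the constant `χ(f)` in the GNS space of `χ`. (The squared distance from `f'` to `χ(f)`
equals `χ(f'* f') - |χ(f)|²`.) -/
def IsUniformlyCentred (X : Set (Γ → ℂ)) : Prop :=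
  ∀ f : Γ →₀ ℂ, ∀ ε > 0, ∃ f' : Γ →₀ ℂ, (∀ ψ, IsTrace ψ → ev ψ f' = ev ψ f) ∧
    ∀ χ ∈ X, sqNorm χ f' ≤ ‖ev χ f‖ ^ 2 + ε

theorem isUniformlyCentred_closure (hX : IsUniformlyCentred X) :
    IsUniformlyCentred (closure X) := by
  intro f ε hε
  obtain ⟨f', h1, h2⟩ := hX f ε hε
  refine ⟨f', h1, fun χ hχ => ?_⟩
  exact closure_minimal (t := {χ : Γ → ℂ | sqNorm χ f' ≤ ‖ev χ f‖ ^ 2 + ε}) h2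
    (isClosed_le (continuous_sqNorm f') (((continuous_ev f).norm.pow 2).add_const _)) hχ

/-- A trace which occurs in a convex decomposition of `φ` is dominated by a multiple of `φ`. -/
theorem exists_sqNorm_le_of_mem_openSegment {ψ' : Γ → ℂ} (hψ' : IsTrace ψ')
    (hφ : φ ∈ openSegment ℝ ψ ψ') : ∃ C, 0 ≤ C ∧ ∀ f, sqNorm ψ f ≤ C * sqNorm φ f := by
  obtain ⟨s, t, hs, ht, -, rfl⟩ := hφ
  refine ⟨s⁻¹, by positivity, fun f => ?_⟩
  simp only [← reEv_starSquare, map_add, map_smul, smul_eq_mul]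
  have h1 : 0 ≤ reEv (starSquare f) ψ' := by rw [reEv_starSquare]; exact sqNorm_nonneg hψ' f
  rw [mul_add, inv_mul_cancel_left₀ hs.ne']
  have : 0 ≤ s⁻¹ * (t * reEv (starSquare f) ψ') := by positivity
  linarith

/-- The traces of a uniformly centred set are extreme: if `ψ` is dominated by `φ`, then
`ψ(f) = ψ(f')` is close to `φ(f)` because `f'` is close to the constant `φ(f)`. -/
theorem IsUniformlyCentred.subset_characters (hX : IsUniformlyCentred X) (hXt : X ⊆ traces Γ) :
    X ⊆ characters Γ := by
  intro φ hφX
  have hφ : IsTrace φ := hXt hφX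
  refine ⟨hφ, fun ψ (hψ : IsTrace ψ) ψ' hψ' hseg => ?_⟩
  obtain ⟨C, hC, hdom⟩ := exists_sqNorm_le_of_mem_openSegment hψ' hseg
  have key : ∀ f, ‖ev ψ f - ev φ f‖ ^ 2 ≤ 0 := by
    intro f
    refine le_of_forall_pos_le_add fun ε hε => ?_
    obtain ⟨f', h1, h2⟩ := hX f (ε / (C + 1)) (by positivity)
    have h3 := norm_ev_sq_le hψ (f' - ev φ f' • unit)
    rw [map_sub, map_smul, ev_unit hψ, smul_eq_mul, mul_one] at h3
    have h4 := hdom (f' - ev φ f' • unit)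
    rw [sqNorm_sub_ev hφ] at h4
    rw [h1 ψ hψ] at h3
    rw [h1 φ hφ] at h3 h4
    have h5 := h2 φ hφX
    have h6 : C * (sqNorm φ f' - ‖ev φ f‖ ^ 2) ≤ C * (ε / (C + 1)) := by gcongr; linarith
    have h7 : C * (ε / (C + 1)) ≤ ε := by
      rw [mul_div_assoc', div_le_iff₀ (by positivity)]; nlinarith
    linarith
  ext g
  have h1 := key (Finsupp.single g 1)
  simp only [ev_single, one_mul] at h1
  have h2 : ‖ψ g - φ g‖ = 0 := by nlinarith [norm_nonneg (ψ g - φ g)]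
  exact sub_eq_zero.1 (norm_eq_zero.1 h2)

theorem apply_le_of_mem_closure_convexHull {E : Type*} [AddCommGroup E] [Module ℝ E]
    [TopologicalSpace E] {X : Set E} {x : E} (hx : x ∈ closure (convexHull ℝ X)) (F : E →L[ℝ] ℝ)
    {M : ℝ} (hM : ∀ y ∈ X, F y ≤ M) : F x ≤ M :=
  closure_minimal (t := {y | F y ≤ M})
    (convexHull_min hM (convex_halfSpace_le F.toLinearMap.isLinear M))
    (isClosed_le F.continuous continuous_const) hx

/-- A trace `ψ` dominated by a point of the closed convex hull of a uniformly centred set `X` is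
bounded for the supremum norm over `X`. -/
theorem IsUniformlyCentred.abs_reEv_le (hX : IsUniformlyCentred X) (hXt : X ⊆ traces Γ)
    (hφ : φ ∈ closure (convexHull ℝ X)) (hψ : IsTrace ψ) {C : ℝ} (hC : 0 ≤ C)
    (hdom : ∀ f, sqNorm ψ f ≤ C * sqNorm φ f) (f : Γ →₀ ℂ) {M : ℝ} (hM0 : 0 ≤ M)
    (hM : ∀ χ ∈ X, |reEv f χ| ≤ M) : |reEv f ψ| ≤ √C * M := by
  have key : reEv f ψ ^ 2 ≤ C * M ^ 2 := by
    refine le_of_forall_pos_le_add fun ε hε => ?_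
    obtain ⟨f', h1, h2⟩ := hX (selfAdjPart f) (ε / (C + 1)) (by positivity)
    have hre : ∀ χ, IsTrace χ → ‖ev χ (selfAdjPart f)‖ ^ 2 = reEv f χ ^ 2 := by
      intro χ hχ
      rw [ev_selfAdjPart hχ, Complex.norm_real, Real.norm_eq_abs, sq_abs, reEv_apply]
    have h3 := norm_ev_sq_le hψ f'
    rw [h1 ψ hψ, hre ψ hψ] at h3
    have h4 : sqNorm φ f' ≤ M ^ 2 + ε / (C + 1) := by
      rw [← reEv_starSquare]
      refine apply_le_of_mem_closure_convexHull hφ _ fun χ hχ => ?_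
      rw [reEv_starSquare]
      have h5 := h2 χ hχ
      rw [hre χ (hXt hχ), ← sq_abs] at h5
      have h6 : |reEv f χ| ^ 2 ≤ M ^ 2 := by gcongr; exact hM χ hχ
      linarith
    have h7 : C * sqNorm φ f' ≤ C * (M ^ 2 + ε / (C + 1)) := by gcongr
    have h8 : C * (ε / (C + 1)) ≤ ε := by
      rw [mul_div_assoc', div_le_iff₀ (by positivity)]; nlinarith
    have h9 := hdom f'
    linarith
  rw [← Real.sqrt_sq hM0, ← Real.sqrt_mul hC, ← Real.sqrt_sq_eq_abs]
  exact Real.sqrt_le_sqrt key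

/-! ### Continuous functions on a compact uniformly centred set -/

variable [CompactSpace X]

/-- The square of the function `χ ↦ Re χ(f)` is a uniform limit of functions `χ ↦ χ(a* a)`. -/
theorem IsUniformlyCentred.sq_mem_closure (hX : IsUniformlyCentred X) (hXt : X ⊆ traces Γ)
    (f : Γ →₀ ℂ) : toContinuousMap X f ^ 2 ∈
      closure (Set.range fun a : Γ →₀ ℂ => toContinuousMap X (starSquare a)) := by
  rw [Metric.mem_closure_range_iff]
  intro ε hε
  obtain ⟨f', h1, h2⟩ := hX (selfAdjPart f) (ε / 2) (by positivity)
  refine ⟨f', lt_of_le_of_lt ?_ (half_lt_self hε)⟩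
  rw [ContinuousMap.dist_le (by positivity)]
  intro χ
  have hχ : IsTrace (χ : Γ → ℂ) := hXt χ.2
  have h3 := h2 χ χ.2
  have h4 := norm_ev_sq_le hχ f'
  rw [h1 _ hχ] at h4
  rw [ev_selfAdjPart hχ, Complex.norm_real, Real.norm_eq_abs, sq_abs, ← reEv_apply] at h3 h4
  rw [ContinuousMap.pow_apply, toContinuousMap_apply, toContinuousMap_apply, reEv_starSquare,
    Real.dist_eq, abs_le]
  constructor <;> linarith

/-- The functions `χ ↦ Re χ(f)` are dense in the continuous functions on `X`: their closure is
stable under squares, hence a subalgebra, and the Stone–Weierstrass theorem applies. -/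
theorem IsUniformlyCentred.denseRange (hX : IsUniformlyCentred X) (hXt : X ⊆ traces Γ) :
    DenseRange (toContinuousMap X) := by
  let V : Submodule ℝ C(X, ℝ) := (LinearMap.range (toContinuousMap X)).topologicalClosure
  have hVcl : IsClosed (V : Set C(X, ℝ)) := Submodule.isClosed_topologicalClosure _
  have hV : ∀ f, toContinuousMap X f ∈ V := fun f =>
    Submodule.le_topologicalClosure _ ⟨f, rfl⟩
  have hsq : ∀ v ∈ V, v ^ 2 ∈ V := by
    intro v hv
    have h1 : Set.MapsTo (fun w : C(X, ℝ) => w ^ 2) (LinearMap.range (toContinuousMap X)) V := by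
      rintro _ ⟨f, rfl⟩
      refine closure_minimal ?_ hVcl (hX.sq_mem_closure hXt f)
      rintro _ ⟨a, rfl⟩
      exact hV _
    have h2 := map_mem_closure (continuous_pow 2) hv h1
    rwa [hVcl.closure_eq] at h2
  let A : Subalgebra ℝ C(X, ℝ) :=
    { carrier := V
      add_mem' := V.add_mem
      mul_mem' := by
        intro a b ha hb
        have : a * b = (2⁻¹ : ℝ) • ((a + b) ^ 2 - a ^ 2 - b ^ 2) := by
          ext χ; simp; ring
        rw [this]
        exact V.smul_mem _ (V.sub_mem (V.sub_mem (hsq _ (V.add_mem ha hb)) (hsq _ ha)) (hsq _ hb))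
      algebraMap_mem' := by
        intro r
        have : algebraMap ℝ C(X, ℝ) r = toContinuousMap X ((r : ℂ) • unit) := by
          ext χ
          simp [toContinuousMap_apply, reEv_apply, ev_unit (hXt χ.2 : IsTrace (χ : Γ → ℂ))]
        exact this ▸ hV _ }
  have hsep : A.SeparatesPoints := by
    intro χ χ' hne
    have : ∃ g, (χ : Γ → ℂ) g ≠ (χ' : Γ → ℂ) g := by
      by_contra! h
      exact hne (Subtype.ext (funext h))
    obtain ⟨g, hg⟩ := this
    by_cases hre : ((χ : Γ → ℂ) g).re = ((χ' : Γ → ℂ) g).re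
    · refine ⟨_, ⟨_, hV (Finsupp.single g Complex.I), rfl⟩, ?_⟩
      simp only [toContinuousMap_apply, reEv_apply, ev_single, Complex.I_mul_re]
      exact fun him => hg (Complex.ext hre (neg_injective him))
    · refine ⟨_, ⟨_, hV (Finsupp.single g 1), rfl⟩, ?_⟩
      simpa only [toContinuousMap_apply, reEv_apply, ev_single, one_mul] using hre
  have htop := ContinuousMap.subalgebra_topologicalClosure_eq_top_of_separatesPoints A hsep
  intro v
  have hv : v ∈ A.topologicalClosure := by rw [htop]; trivial
  have hv' : v ∈ closure (V : Set C(X, ℝ)) := hv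
  rw [hVcl.closure_eq] at hv'
  exact hv'

/-- Nonnegative continuous functions on `X` are uniform limits of functions `χ ↦ χ(a* a)`. -/
theorem IsUniformlyCentred.nonneg_mem_closure (hX : IsUniformlyCentred X) (hXt : X ⊆ traces Γ)
    {k : C(X, ℝ)} (hk : 0 ≤ k) :
    k ∈ closure (Set.range fun a : Γ →₀ ℂ => toContinuousMap X (starSquare a)) := by
  let s : C(X, ℝ) := ⟨fun χ => √(k χ), by fun_prop⟩
  have hs : k = s ^ 2 := by ext χ; exact (Real.sq_sqrt (hk χ)).symm
  have h1 : Set.MapsTo (fun w : C(X, ℝ) => w ^ 2) (Set.range (toContinuousMap X))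
      (closure (Set.range fun a : Γ →₀ ℂ => toContinuousMap X (starSquare a))) := by
    rintro _ ⟨f, rfl⟩
    exact hX.sq_mem_closure hXt f
  have h2 := map_mem_closure (continuous_pow 2) (hX.denseRange hXt s) h1
  rw [closure_closure] at h2
  rwa [hs]

/-- A trace which is bounded for the supremum norm over `X` extends to a positive functional on the
continuous functions on `X`. -/
theorem IsUniformlyCentred.exists_positive_functional (hX : IsUniformlyCentred X)
    (hXt : X ⊆ traces Γ) (hψ : IsTrace ψ) {C : ℝ}
    (hb : ∀ (f : Γ →₀ ℂ) (M : ℝ), 0 ≤ M → (∀ χ ∈ X, |reEv f χ| ≤ M) → |reEv f ψ| ≤ C * M) :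
    ∃ L : C(X, ℝ) →L[ℝ] ℝ, (∀ f, L (toContinuousMap X f) = reEv f ψ) ∧ ∀ k, 0 ≤ k → 0 ≤ L k := by
  let l : (Γ →₀ ℂ) →ₗ[ℝ] ℝ :=
    { toFun := fun f => reEv f ψ
      map_add' := fun f g => by simp [reEv_apply]
      map_smul' := fun c f => by simp [reEv_apply] }
  have hl : ∀ f, l.extendOfNorm (toContinuousMap X) (toContinuousMap X f) = reEv f ψ := fun f =>
    LinearMap.extendOfNorm_eq (hX.denseRange hXt)
      ⟨C, fun f => hb f _ (norm_nonneg _) fun χ hχ =>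
        (toContinuousMap X f).norm_coe_le_norm ⟨χ, hχ⟩⟩ f
  refine ⟨l.extendOfNorm (toContinuousMap X), hl, fun k hk => ?_⟩
  refine closure_minimal (t := {k | 0 ≤ l.extendOfNorm (toContinuousMap X) k}) ?_
    (isClosed_le continuous_const (ContinuousLinearMap.continuous _))
    (hX.nonneg_mem_closure hXt hk)
  rintro _ ⟨a, rfl⟩
  change 0 ≤ l.extendOfNorm (toContinuousMap X) (toContinuousMap X (starSquare a))
  rw [hl, reEv_starSquare]
  exact sqNorm_nonneg hψ a

end Centred

section Barycenters

/-! ### Barycenters -/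

variable {Γ : Type u}

theorem eq_of_forall_continuousLinearMap_eq {φ ψ : Γ → ℂ}
    (h : ∀ F : (Γ → ℂ) →L[ℝ] ℝ, F φ = F ψ) : φ = ψ := by
  by_contra hne
  obtain ⟨F, hF⟩ := geometric_hahn_banach_point_point hne
  exact hF.ne (h F)

variable [Countable Γ] {X : Set (Γ → ℂ)} {φ : Γ → ℂ}

theorem integrable_continuousLinearMap (hX : IsCompact X) {μ : Measure (Γ → ℂ)}
    [IsFiniteMeasure μ] (hμ : μ Xᶜ = 0) (F : (Γ → ℂ) →L[ℝ] ℝ) : Integrable F μ := by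
  obtain ⟨C, hC⟩ := hX.exists_bound_of_continuousOn F.continuous.continuousOn
  refine Integrable.of_bound F.continuous.aestronglyMeasurable C ?_
  have : ∀ᵐ χ ∂μ, χ ∈ X := hμ
  filter_upwards [this] with χ hχ using hC χ hχ

/-- The barycenter of a probability measure carried by `X` lies in the closed convex hull. -/
theorem mem_closure_convexHull_of_integral_eq (hX : IsCompact X) {μ : Measure (Γ → ℂ)}
    [IsProbabilityMeasure μ] (hμ : μ Xᶜ = 0)
    (hφ : ∀ F : (Γ → ℂ) →L[ℝ] ℝ, ∫ χ, F χ ∂μ = F φ) : φ ∈ closure (convexHull ℝ X) := by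
  by_contra hnot
  obtain ⟨F, c, hF, hc⟩ :=
    geometric_hahn_banach_closed_point (convex_convexHull ℝ X).closure isClosed_closure hnot
  have h1 : ∫ χ, F χ ∂μ ≤ ∫ _, c ∂μ := by
    refine integral_mono_ae (integrable_continuousLinearMap hX hμ F) (integrable_const c) ?_
    have : ∀ᵐ χ ∂μ, χ ∈ X := hμ
    filter_upwards [this] with χ hχ using (hF χ (subset_closure (subset_convexHull ℝ X hχ))).le
  rw [hφ] at h1
  simp at h1
  linarith

theorem exists_barycenter (hX : IsCompact X) {μ : Measure (Γ → ℂ)}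
    [IsProbabilityMeasure μ] (hμ : μ Xᶜ = 0) :
    ∃ φ : Γ → ℂ, ∀ F : (Γ → ℂ) →L[ℝ] ℝ, ∫ χ, F χ ∂μ = F φ := by
  have hint : ∀ g : Γ, Integrable (fun χ : Γ → ℂ => χ g) μ := by
    intro g
    obtain ⟨C, hC⟩ := hX.exists_bound_of_continuousOn (continuous_apply g).continuousOn
    refine Integrable.of_bound (continuous_apply g).aestronglyMeasurable C ?_
    have : ∀ᵐ χ ∂μ, χ ∈ X := hμ
    filter_upwards [this] with χ hχ using hC χ hχ
  refine ⟨fun g => ∫ χ, χ g ∂μ, fun F => ?_⟩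
  obtain ⟨f, rfl⟩ := exists_reEv_eq F
  simp only [reEv_apply, ev_apply, Finsupp.sum]
  have h1 := integral_re (𝕜 := ℂ) (μ := μ) (f := fun χ : Γ → ℂ => ∑ g ∈ f.support, f g * χ g)
    (integrable_finsetSum _ fun g _ => (hint g).const_mul _)
  refine h1.trans ?_
  rw [integral_finsetSum _ fun g _ => (hint g).const_mul _]
  simp only [integral_const_mul]
  rfl

/-- A point which is extreme in the closed convex hull of a compact set `X` and is the barycenter of
a probability measure carried by `X` belongs to `X`: if the measure charges both `B` and its
complement, extremality forces the barycenters of the two conditional measures to be equal. -/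
theorem mem_of_mem_extremePoints_of_integral_eq (hX : IsCompact X)
    (hφK : φ ∈ Set.extremePoints ℝ (closure (convexHull ℝ X))) {μ : Measure (Γ → ℂ)}
    [IsProbabilityMeasure μ] (hμ : μ Xᶜ = 0)
    (hφ : ∀ F : (Γ → ℂ) →L[ℝ] ℝ, ∫ χ, F χ ∂μ = F φ) : φ ∈ X := by
  have hint := fun F => integrable_continuousLinearMap (μ := μ) hX hμ F
  -- the barycenter of the measure conditioned on `B`
  have hcond : ∀ B : Set (Γ → ℂ), μ B ≠ 0 → ∃ b ∈ closure (convexHull ℝ X),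
      ∀ F : (Γ → ℂ) →L[ℝ] ℝ, ∫ χ in B, F χ ∂μ = μ.real B * F b := by
    intro B hB
    have hprob : IsProbabilityMeasure (ProbabilityTheory.cond μ B) :=
      ProbabilityTheory.cond_isProbabilityMeasure hB
    have hcX : ProbabilityTheory.cond μ B Xᶜ = 0 :=
      ProbabilityTheory.cond_absolutelyContinuous hμ
    obtain ⟨b, hb⟩ := exists_barycenter hX hcX
    refine ⟨b, mem_closure_convexHull_of_integral_eq hX hcX hb, fun F => ?_⟩
    rw [← hb F, ProbabilityTheory.cond, integral_smul_measure, smul_eq_mul, ENNReal.toReal_inv,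
      ← mul_assoc, Measure.real, mul_inv_cancel₀, one_mul]
    exact (ENNReal.toReal_pos hB (measure_ne_top μ B)).ne'
  have hset : ∀ B : Set (Γ → ℂ), MeasurableSet B → ∀ F : (Γ → ℂ) →L[ℝ] ℝ,
      ∫ χ in B, F χ ∂μ = μ.real B * F φ := by
    intro B hBm F
    have hadd : ∀ F : (Γ → ℂ) →L[ℝ] ℝ, ∫ χ in B, F χ ∂μ + ∫ χ in Bᶜ, F χ ∂μ = F φ :=
      fun F => by rw [integral_add_compl hBm (hint F), hφ]
    have hreal : μ.real B + μ.real Bᶜ = 1 := by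
      rw [measureReal_add_measureReal_compl hBm]; simp
    by_cases h0 : μ B = 0
    · rw [Measure.restrict_eq_zero.2 h0]; simp [Measure.real, h0]
    by_cases h1 : μ Bᶜ = 0
    · have h2 := hadd F
      have h3 : μ.real Bᶜ = 0 := by simp [Measure.real, h1]
      rw [Measure.restrict_eq_zero.2 h1, integral_zero_measure, add_zero] at h2
      rw [h3, add_zero] at hreal
      rw [h2, hreal, one_mul]
    obtain ⟨b, hbK, hb⟩ := hcond B h0
    obtain ⟨c, hcK, hc⟩ := hcond Bᶜ h1
    have hseg : φ ∈ openSegment ℝ b c := by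
      refine ⟨μ.real B, μ.real Bᶜ, ENNReal.toReal_pos h0 (measure_ne_top _ _),
        ENNReal.toReal_pos h1 (measure_ne_top _ _), hreal, ?_⟩
      refine eq_of_forall_continuousLinearMap_eq fun F => ?_
      rw [map_add, map_smul, map_smul, smul_eq_mul, smul_eq_mul, ← hb, ← hc, hadd]
    rw [hb, hφK.2 hbK hcK hseg]
  have hae : ∀ F : (Γ → ℂ) →L[ℝ] ℝ, ∀ᵐ χ ∂μ, F χ = F φ := fun F => by
    refine (hint F).ae_eq_of_forall_setIntegral_eq _ _ (integrable_const (F φ)) fun B hB _ => ?_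
    rw [hset B hB F]
    simp
  -- countably many functionals separate points, so the measure is the point mass at `φ`
  have hall : ∀ᵐ χ ∂μ, ∀ g : Γ, reEv (Finsupp.single g 1) χ = reEv (Finsupp.single g 1) φ ∧
      reEv (Finsupp.single g Complex.I) χ = reEv (Finsupp.single g Complex.I) φ :=
    ae_all_iff.2 fun g => (hae _).and (hae _)
  have hXae : ∀ᵐ χ ∂μ, χ ∈ X := hμ
  obtain ⟨χ, hχ, hχX⟩ := (hall.and hXae).exists
  have : χ = φ := by
    ext g
    have h1 := hχ g
    simp only [reEv_apply, ev_single, one_mul, Complex.I_mul_re, neg_inj] at h1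
    exact Complex.ext h1.1 h1.2
  exact this ▸ hχX

/-! ### The simplex spanned by a uniformly centred set -/

variable [Group Γ] {ψ : Γ → ℂ}

/-- A trace which is bounded for the supremum norm over `X` is the barycenter of a probability
measure carried by `X`. -/
theorem IsUniformlyCentred.exists_measure (hX : IsUniformlyCentred X) (hXt : X ⊆ traces Γ)
    (hXc : IsCompact X) (hψ : IsTrace ψ) {C : ℝ}
    (hb : ∀ (f : Γ →₀ ℂ) (M : ℝ), 0 ≤ M → (∀ χ ∈ X, |reEv f χ| ≤ M) → |reEv f ψ| ≤ C * M) :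
    ∃ μ : Measure (Γ → ℂ), IsProbabilityMeasure μ ∧ μ Xᶜ = 0 ∧
      ∀ F : (Γ → ℂ) →L[ℝ] ℝ, ∫ χ, F χ ∂μ = F ψ := by
  have : CompactSpace X := isCompact_iff_compactSpace.1 hXc
  obtain ⟨L, hL, hpos⟩ := hX.exists_positive_functional hXt hψ hb
  let P : CompactlySupportedContinuousMap X ℝ →ₚ[ℝ] ℝ := PositiveLinearMap.mk₀
    { toFun := fun f => L f.toContinuousMap
      map_add' := fun f g => map_add L f.toContinuousMap g.toContinuousMap
      map_smul' := fun c f => map_smul L c f.toContinuousMap }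
    fun f hf => hpos f.toContinuousMap hf
  let ν : Measure X := RealRMK.rieszMeasure P
  have hν : ∀ f : Γ →₀ ℂ, ∫ χ : X, reEv f χ ∂ν = reEv f ψ := fun f => by
    rw [← hL f]
    exact RealRMK.integral_rieszMeasure P
      (CompactlySupportedContinuousMap.continuousMapEquiv (toContinuousMap X f))
  have hνprob : IsProbabilityMeasure ν := by
    have h1 := hν unit
    have h2 : ∀ χ : X, reEv unit (χ : Γ → ℂ) = 1 := fun χ => by
      rw [reEv_apply, ev_unit (hXt χ.2 : IsTrace (χ : Γ → ℂ)), Complex.one_re]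
    simp only [h2] at h1
    rw [reEv_apply, ev_unit hψ, Complex.one_re] at h1
    simp only [integral_const, smul_eq_mul, mul_one, Measure.real] at h1
    exact ⟨(ENNReal.toReal_eq_one_iff _).1 h1⟩
  have hmeas : MeasurableSet X := hXc.isClosed.measurableSet
  refine ⟨ν.map Subtype.val, Measure.isProbabilityMeasure_map measurable_subtype_coe.aemeasurable,
    ?_, fun F => ?_⟩
  · rw [Measure.map_apply measurable_subtype_coe hmeas.compl]
    convert measure_empty (μ := ν)
    ext χ
    simp
  · obtain ⟨f, rfl⟩ := exists_reEv_eq F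
    rw [(MeasurableEmbedding.subtype_coe hmeas).integral_map]
    exact hν f

/-- A probability measure carried by a uniformly centred compact set is determined by its
barycenter, because the functions `χ ↦ Re χ(f)` are dense. -/
theorem IsUniformlyCentred.measure_unique (hX : IsUniformlyCentred X) (hXt : X ⊆ traces Γ)
    (hXc : IsCompact X) {μ ν : Measure (Γ → ℂ)} [IsProbabilityMeasure μ] [IsProbabilityMeasure ν]
    (hμ : μ Xᶜ = 0) (hν : ν Xᶜ = 0)
    (heq : ∀ F : (Γ → ℂ) →L[ℝ] ℝ, ∫ χ, F χ ∂μ = ∫ χ, F χ ∂ν) : μ = ν := by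
  have : CompactSpace X := isCompact_iff_compactSpace.1 hXc
  refine ext_of_forall_integral_eq_of_IsFiniteMeasure fun k => ?_
  let kX : C(X, ℝ) := k.toContinuousMap.restrict X
  have key : ∀ ε > 0, dist (∫ χ, k χ ∂μ) (∫ χ, k χ ∂ν) ≤ 2 * ε := by
    intro ε hε
    obtain ⟨f, hf⟩ := (hX.denseRange hXt).exists_dist_lt kX hε
    have hest : ∀ (m : Measure (Γ → ℂ)) [IsProbabilityMeasure m], m Xᶜ = 0 →
        dist (∫ χ, k χ ∂m) (∫ χ, reEv f χ ∂m) ≤ ε := by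
      intro m _ hm
      rw [dist_eq_norm, ← integral_sub (k.integrable m) (integrable_continuousLinearMap hXc hm _)]
      refine (norm_integral_le_of_norm_le_const (C := ε) ?_).trans (by simp)
      have hXae : ∀ᵐ χ ∂m, χ ∈ X := hm
      filter_upwards [hXae] with χ hχ
      rw [← dist_eq_norm]
      exact (ContinuousMap.dist_apply_le_dist (f := kX) (g := toContinuousMap X f) ⟨χ, hχ⟩).trans
        hf.le
    have h1 := hest μ hμ
    have h2 := hest ν hν
    rw [heq, dist_comm] at h1
    rw [dist_comm (∫ χ, k χ ∂μ)]
    have := dist_triangle_left (∫ χ, k χ ∂ν) (∫ χ, k χ ∂μ) (∫ χ, reEv f χ ∂ν)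
    rw [dist_comm] at h2
    linarith
  refine dist_le_zero.1 (le_of_forall_pos_le_add fun ε hε => ?_)
  have := key (ε / 2) (by positivity)
  linarith

/-- The closed convex hull of a uniformly centred set of traces is a closed face of the set of
traces and a Bauer simplex. -/
theorem IsUniformlyCentred.isClosedFace_and_isBauerSimplex (hX : IsUniformlyCentred X)
    (hXt : X ⊆ traces Γ) : closure X ⊆ characters Γ ∧
      IsClosedFace (traces Γ) (closure (convexHull ℝ X)) ∧
      IsBauerSimplex (closure (convexHull ℝ X)) := by
  have hYt : closure X ⊆ traces Γ := closure_minimal hXt isClosed_traces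
  have hYc : IsCompact (closure X) := isCompact_traces.of_isClosed_subset isClosed_closure hYt
  have hY : IsUniformlyCentred (closure X) := isUniformlyCentred_closure hX
  have hK : closure (convexHull ℝ X) = closure (convexHull ℝ (closure X)) :=
    (closure_mono (convexHull_mono subset_closure)).antisymm <|
      closure_minimal (convexHull_min (closure_mono (subset_convexHull ℝ X))
        (convex_convexHull ℝ X).closure) isClosed_closure
  rw [hK]
  generalize closure X = Y at hYt hYc hY
  have hYch := hY.subset_characters hYt
  have hKt : closure (convexHull ℝ Y) ⊆ traces Γ :=
    closure_minimal (convexHull_min hYt convex_traces) isClosed_traces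
  have hrep : ∀ φ ∈ closure (convexHull ℝ Y), ∀ ψ, IsTrace ψ →
      (∃ C, 0 ≤ C ∧ ∀ f, sqNorm ψ f ≤ C * sqNorm φ f) →
      ∃ μ : Measure (Γ → ℂ), IsProbabilityMeasure μ ∧ μ Yᶜ = 0 ∧
        ∀ F : (Γ → ℂ) →L[ℝ] ℝ, ∫ χ, F χ ∂μ = F ψ := by
    rintro φ hφ ψ hψ ⟨C, hC, hdom⟩
    exact hY.exists_measure hYt hYc hψ fun f M => hY.abs_reEv_le hYt hφ hψ hC hdom f
  have hself : ∀ φ ∈ closure (convexHull ℝ Y), ∃ μ : Measure (Γ → ℂ), IsProbabilityMeasure μ ∧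
      μ Yᶜ = 0 ∧ ∀ F : (Γ → ℂ) →L[ℝ] ℝ, ∫ χ, F χ ∂μ = F φ := fun φ hφ =>
    hrep φ hφ φ (hKt hφ) ⟨1, zero_le_one, fun f => (one_mul _).ge⟩
  have hext : IsExtreme ℝ (traces Γ) (closure (convexHull ℝ Y)) := by
    refine ⟨hKt, fun ψ hψ ψ' hψ' φ hφ hseg => ?_⟩
    obtain ⟨μ, hμ, hμY, hF⟩ := hrep φ hφ ψ hψ (exists_sqNorm_le_of_mem_openSegment hψ' hseg)
    exact mem_closure_convexHull_of_integral_eq hYc hμY hF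
  have hpts : Set.extremePoints ℝ (closure (convexHull ℝ Y)) = Y := by
    apply Set.Subset.antisymm
    · intro φ hφ
      obtain ⟨μ, hμ, hμY, hF⟩ := hself φ hφ.1
      exact mem_of_mem_extremePoints_of_integral_eq hYc hφ hμY hF
    · intro φ hφ
      rw [hext.extremePoints_eq]
      exact ⟨subset_closure (subset_convexHull ℝ Y hφ), hYch hφ⟩
  refine ⟨hYch, ⟨isClosed_closure, (convex_convexHull ℝ Y).closure, hext⟩, ⟨⟨?_, ?_, ?_, ?_⟩, ?_⟩⟩
  · exact isCompact_traces.of_isClosed_subset isClosed_closure hKt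
  · infer_instance
  · exact (convex_convexHull ℝ Y).closure
  · intro φ hφ
    rw [hpts]
    obtain ⟨μ, hμ, hμY, hF⟩ := hself φ hφ
    refine ⟨μ, ⟨hμ, hμY, hF⟩, ?_⟩
    rintro ν ⟨hν, hνY, hG⟩
    exact hY.measure_unique hYt hYc hνY hμY fun F => (hG F).trans (hF F).symm
  · rw [hpts]
    exact hYc.isClosed

end Barycenters

section Kazhdan

/-! ### The bi-regular representation of a trace -/

variable {Γ : Type u} [Group Γ] {φ : Γ → ℂ}

/-- The permutation `x ↦ g x k⁻¹` of the group, for `p = (g, k)`. -/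
def biPerm (p : Γ × Γ) : Γ ≃ Γ := (Equiv.mulLeft p.1).trans (Equiv.mulRight p.2⁻¹)

theorem biPerm_apply (p : Γ × Γ) (x : Γ) : biPerm p x = p.1 * x * p.2⁻¹ := rfl

/-- Two-sided translation on the group ring, `δ_x ↦ δ_{g x k⁻¹}`. -/
def biShift (p : Γ × Γ) : (Γ →₀ ℂ) ≃ₗ[ℂ] (Γ →₀ ℂ) := Finsupp.domLCongr (biPerm p)

theorem biShift_single (p : Γ × Γ) (x : Γ) (a : ℂ) :
    biShift p (Finsupp.single x a) = Finsupp.single (p.1 * x * p.2⁻¹) a := by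
  simp [biShift, biPerm_apply]

theorem biShift_mul (p q : Γ × Γ) (f : Γ →₀ ℂ) :
    biShift (p * q) f = biShift p (biShift q f) := by
  induction f using Finsupp.induction_linear with
  | zero => simp
  | add f g hf hg => simp only [map_add, hf, hg]
  | single x a => simp [biShift_single, mul_assoc]

theorem biShift_one (f : Γ →₀ ℂ) : biShift 1 f = f := by
  induction f using Finsupp.induction_linear with
  | zero => simp
  | add f g hf hg => simp only [map_add, hf, hg]
  | single x a => simp [biShift_single]

theorem ev_biShift_diag (h : IsTrace φ) (g : Γ) (f : Γ →₀ ℂ) :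
    ev φ (biShift (g, g) f) = ev φ f := by
  induction f using Finsupp.induction_linear with
  | zero => simp
  | add f g hf hg => simp only [map_add, hf, hg]
  | single x a =>
    rw [biShift_single, ev_single, ev_single, ← h.conj_inv x g⁻¹, inv_inv]

theorem form_biShift (h : IsTrace φ) (p : Γ × Γ) (f g : Γ →₀ ℂ) :
    GNS.form φ (biShift p f) (biShift p g) = GNS.form φ f g := by
  simp only [GNS.form, biShift, Finsupp.domLCongr_apply, Finsupp.domCongr_apply,
    Finsupp.equivMapDomain_eq_mapDomain]
  rw [Finsupp.sum_mapDomain_index_inj (Equiv.injective _)]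
  refine Finsupp.sum_congr fun x _ => ?_
  rw [Finsupp.sum_mapDomain_index_inj (Equiv.injective _)]
  refine Finsupp.sum_congr fun y _ => ?_
  rw [biPerm_apply, biPerm_apply, ← h.conj_inv (x⁻¹ * y) p.2⁻¹]
  congr 2
  group

/-- Two-sided translation as an isometry of the pre-Hilbert space. -/
def preBiTranslation (h : IsTrace φ) (p : Γ × Γ) : GNS.PreSpace h →ₗᵢ[ℂ] GNS.PreSpace h where
  toLinearMap := (biShift p).toLinearMap
  norm_map' f := by
    rw [@norm_eq_sqrt_re_inner ℂ, @norm_eq_sqrt_re_inner ℂ _ _ _ _ f, GNS.inner_def, GNS.inner_def]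
    exact congrArg (fun z => √(RCLike.re z)) (form_biShift h p f f)

/-- The isometry of the completion induced by two-sided translation. -/
def biTranslation (h : IsTrace φ) (p : Γ × Γ) :
    UniformSpace.Completion (GNS.PreSpace h) →L[ℂ] UniformSpace.Completion (GNS.PreSpace h) :=
  (preBiTranslation h p).toContinuousLinearMap.completion

theorem biTranslation_coe (h : IsTrace φ) (p : Γ × Γ) (f : GNS.PreSpace h) :
    biTranslation h p (f : UniformSpace.Completion (GNS.PreSpace h)) =
      (preBiTranslation h p f : GNS.PreSpace h) :=
  ContinuousLinearMap.completion_apply_coe _ _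

theorem biTranslation_mul (h : IsTrace φ) (p q : Γ × Γ)
    (v : UniformSpace.Completion (GNS.PreSpace h)) :
    biTranslation h (p * q) v = biTranslation h p (biTranslation h q v) := by
  induction v using UniformSpace.Completion.induction_on with
  | hp => exact isClosed_eq (by fun_prop) (by fun_prop)
  | ih f =>
    simp only [biTranslation_coe]
    congr 1
    exact biShift_mul p q f

theorem biTranslation_one (h : IsTrace φ) (v : UniformSpace.Completion (GNS.PreSpace h)) :
    biTranslation h 1 v = v := by
  induction v using UniformSpace.Completion.induction_on with
  | hp => exact isClosed_eq (by fun_prop) (by fun_prop)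
  | ih f =>
    simp only [biTranslation_coe]
    congr 1
    exact biShift_one f

theorem norm_biTranslation (h : IsTrace φ) (p : Γ × Γ)
    (v : UniformSpace.Completion (GNS.PreSpace h)) : ‖biTranslation h p v‖ = ‖v‖ := by
  induction v using UniformSpace.Completion.induction_on with
  | hp => exact isClosed_eq (by fun_prop) (by fun_prop)
  | ih f =>
    rw [biTranslation_coe, UniformSpace.Completion.norm_coe, UniformSpace.Completion.norm_coe]
    exact (preBiTranslation h p).norm_map f

/-- The bi-regular representation of `Γ × Γ` on the GNS space of a trace; the conjugation-invariance
of the trace makes right translations unitary. -/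
def biRep (h : IsTrace φ) : UnitaryRep (Γ × Γ) where
  space := UniformSpace.Completion (GNS.PreSpace h)
  hom :=
    { toFun := fun p =>
        { toLinearMap := (biTranslation h p).toLinearMap
          invFun := biTranslation h p⁻¹
          left_inv := fun v => by
            change biTranslation h p⁻¹ (biTranslation h p v) = v
            rw [← biTranslation_mul, inv_mul_cancel, biTranslation_one]
          right_inv := fun v => by
            change biTranslation h p (biTranslation h p⁻¹ v) = v
            rw [← biTranslation_mul, mul_inv_cancel, biTranslation_one]
          norm_map' := norm_biTranslation h p }
      map_one' := by
        ext v
        exact biTranslation_one h v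
      map_mul' := fun p q => by
        ext v
        exact biTranslation_mul h p q v }

theorem inner_biRep_hom_left (h : IsTrace φ) (p : Γ × Γ) (x y : (biRep h).space) :
    inner ℂ ((biRep h).hom p x) y = inner ℂ x ((biRep h).hom p⁻¹ y) := by
  rw [← LinearIsometryEquiv.inner_map_map ((biRep h).hom p⁻¹)]
  congr 1
  change ((biRep h).hom p⁻¹ * (biRep h).hom p) x = x
  rw [← map_mul, inv_mul_cancel, map_one]; rfl

theorem biRep_hom_hom (h : IsTrace φ) (p q : Γ × Γ) (x : (biRep h).space) :
    (biRep h).hom p ((biRep h).hom q x) = (biRep h).hom (p * q) x := by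
  rw [map_mul]; rfl

/-- The class of an element of the group ring in the GNS space. -/
def vec (h : IsTrace φ) (f : Γ →₀ ℂ) : (biRep h).space :=
  ((toPre h f : GNS.PreSpace h) : UniformSpace.Completion (GNS.PreSpace h))

theorem vec_add (h : IsTrace φ) (f g : Γ →₀ ℂ) : vec h (f + g) = vec h f + vec h g := by
  rw [vec, map_add]; exact UniformSpace.Completion.coe_add _ _

theorem vec_smul (h : IsTrace φ) (c : ℂ) (f : Γ →₀ ℂ) : vec h (c • f) = c • vec h f := by
  rw [vec, map_smul]; exact UniformSpace.Completion.coe_smul _ _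

theorem norm_vec_sq (h : IsTrace φ) (f : Γ →₀ ℂ) : ‖vec h f‖ ^ 2 = sqNorm φ f := by
  rw [sqNorm_eq_norm_sq h]
  exact congrArg (· ^ 2) (UniformSpace.Completion.norm_coe _)

theorem inner_vec (h : IsTrace φ) (f g : Γ →₀ ℂ) :
    inner ℂ (vec h f) (vec h g) = GNS.form φ f g :=
  UniformSpace.Completion.inner_coe _ _

theorem biRep_hom_vec (h : IsTrace φ) (p : Γ × Γ) (f : Γ →₀ ℂ) :
    (biRep h).hom p (vec h f) = vec h (biShift p f) :=
  biTranslation_coe h p (toPre h f)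

/-- The class of the group element `g` in the GNS space. -/
def δ (h : IsTrace φ) (g : Γ) : (biRep h).space := vec h (Finsupp.single g 1)

theorem biRep_hom_δ (h : IsTrace φ) (p : Γ × Γ) (g : Γ) :
    (biRep h).hom p (δ h g) = δ h (p.1 * g * p.2⁻¹) := by
  rw [δ, biRep_hom_vec, biShift_single, δ]

theorem inner_δ (h : IsTrace φ) (x y : Γ) : inner ℂ (δ h x) (δ h y) = φ (x⁻¹ * y) := by
  rw [δ, δ, inner_vec]
  simp [GNS.form]

theorem vec_mem_span (h : IsTrace φ) (f : Γ →₀ ℂ) :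
    vec h f ∈ Submodule.span ℂ (Set.range (δ h)) := by
  induction f using Finsupp.induction_linear with
  | zero =>
    rw [← zero_smul ℂ (0 : Γ →₀ ℂ), vec_smul, zero_smul]
    exact Submodule.zero_mem _
  | add f g hf hg => rw [vec_add]; exact Submodule.add_mem _ hf hg
  | single x a =>
    rw [← mul_one a, ← smul_eq_mul, ← Finsupp.smul_single, vec_smul]
    exact Submodule.smul_mem _ _ (Submodule.subset_span ⟨x, rfl⟩)

theorem denseRange_vec (h : IsTrace φ) : DenseRange (vec h) :=
  UniformSpace.Completion.denseRange_coe (α := GNS.PreSpace h)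

theorem eq_zero_of_forall_inner_δ (h : IsTrace φ) {v : (biRep h).space}
    (hv : ∀ g, inner ℂ (δ h g) v = 0) : v = 0 := by
  have h1 : ∀ f, inner ℂ (vec h f) v = 0 := by
    intro f
    refine Submodule.span_induction (p := fun w _ => inner ℂ w v = 0) ?_ ?_ ?_ ?_ (vec_mem_span h f)
    · rintro _ ⟨g, rfl⟩; exact hv g
    · simp
    · intro x y _ _ hx hy; rw [inner_add_left, hx, hy, add_zero]
    · intro c x _ hx; rw [inner_smul_left, hx, mul_zero]
  have h2 : (fun w => inner ℂ w v) = fun _ => (0 : ℂ) :=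
    (denseRange_vec h).equalizer (by fun_prop) (by fun_prop) (funext h1)
  exact inner_self_eq_zero.1 (congrFun h2 v)

theorem translation_eq_biTranslation (h : IsTrace φ) (g : Γ)
    (v : UniformSpace.Completion (GNS.PreSpace h)) :
    GNS.translation h g v = biTranslation h (g, 1) v := by
  induction v using UniformSpace.Completion.induction_on with
  | hp => exact isClosed_eq (by fun_prop) (by fun_prop)
  | ih f =>
    rw [biTranslation_coe, GNS.translation_coe]
    congr 1
    change GNS.shift g f = biShift (g, 1) f
    rw [biShift, GNS.shift]
    congr 1
    congr 1
    ext x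
    simp [biPerm_apply]

theorem isContainedIn_gnsRep (h : IsTrace φ) :
    ((biRep h).comap (MonoidHom.inl Γ Γ)).IsContainedIn (gnsRep φ h) :=
  ⟨LinearIsometry.id, fun g v => (translation_eq_biTranslation h g v).symm⟩

/-- The conjugate-linear involution `f ↦ f*` of the group ring. -/
def starMap : (Γ →₀ ℂ) →ₗ⋆[ℂ] (Γ →₀ ℂ) where
  toFun f := (Finsupp.domCongr (Equiv.inv Γ) f).mapRange conj (map_zero _)
  map_add' f g := by ext x; simp
  map_smul' c f := by ext x; simp

theorem starMap_apply (f : Γ →₀ ℂ) (x : Γ) : starMap f x = conj (f x⁻¹) := by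
  simp [starMap]

theorem starMap_single (x : Γ) (a : ℂ) :
    starMap (Finsupp.single x a) = Finsupp.single x⁻¹ (conj a) := by
  classical
  ext y
  rw [starMap_apply, Finsupp.single_apply, Finsupp.single_apply]
  by_cases hxy : x = y⁻¹
  · rw [if_pos hxy, if_pos (by rw [hxy, inv_inv])]
  · rw [if_neg hxy, if_neg (by rintro rfl; exact hxy (inv_inv x).symm), map_zero]

theorem starMap_starMap (f : Γ →₀ ℂ) : starMap (starMap f) = f := by
  ext x; simp [starMap_apply]

theorem starMap_biShift (g k : Γ) (f : Γ →₀ ℂ) :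
    starMap (biShift (g, k) f) = biShift (k, g) (starMap f) := by
  induction f using Finsupp.induction_linear with
  | zero => simp
  | add f g hf hg => simp only [map_add, hf, hg]
  | single x a => simp [biShift_single, starMap_single, mul_assoc]

theorem form_starMap (h : IsTrace φ) (f g : Γ →₀ ℂ) :
    GNS.form φ (starMap f) (starMap g) = GNS.form φ g f := by
  have hs : ∀ (f : Γ →₀ ℂ) (k : Γ → ℂ → ℂ), (∀ x, k x 0 = 0) →
      (starMap f).sum k = f.sum fun x a => k x⁻¹ (conj a) := by
    intro f k hk
    change Finsupp.sum (Finsupp.mapRange conj (map_zero _)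
      (Finsupp.equivMapDomain (Equiv.inv Γ) f)) k = _
    rw [Finsupp.sum_mapRange_index hk, Finsupp.equivMapDomain_eq_mapDomain,
      Finsupp.sum_mapDomain_index_inj (Equiv.injective _)]
    rfl
  rw [GNS.form, hs _ _ (by simp), GNS.form, Finsupp.sum_comm g f]
  refine Finsupp.sum_congr fun x _ => ?_
  rw [hs _ _ (by simp)]
  refine Finsupp.sum_congr fun y _ => ?_
  rw [← h.conj_inv (y⁻¹ * x) y⁻¹]
  simp [mul_comm]

/-- The involution `f ↦ f*` as an isometry of the pre-Hilbert space of a trace. -/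
def preStar (h : IsTrace φ) : GNS.PreSpace h →ₗᵢ⋆[ℂ] GNS.PreSpace h where
  toFun := starMap (Γ := Γ)
  map_add' := map_add (starMap (Γ := Γ))
  map_smul' := (starMap (Γ := Γ)).map_smulₛₗ
  norm_map' f := by
    rw [@norm_eq_sqrt_re_inner ℂ, @norm_eq_sqrt_re_inner ℂ _ _ _ _ f, GNS.inner_def, GNS.inner_def]
    exact congrArg (fun z => √(RCLike.re z)) (form_starMap h f f)

/-- The modular conjugation of the GNS space of a trace, the extension of `f ↦ f*`. -/
def modularConj (h : IsTrace φ) : (biRep h).space →L⋆[ℂ] (biRep h).space :=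
  (preStar h).toContinuousLinearMap.completion

theorem modularConj_vec (h : IsTrace φ) (f : Γ →₀ ℂ) :
    modularConj h (vec h f) = vec h (starMap f) :=
  ContinuousLinearMap.completion_apply_coe _ _

theorem induction_vec (h : IsTrace φ) {p : (biRep h).space → Prop} (hp : IsClosed {v | p v})
    (ih : ∀ f, p (vec h f)) (v : (biRep h).space) : p v :=
  UniformSpace.Completion.induction_on v hp ih

theorem modularConj_modularConj (h : IsTrace φ) (v : (biRep h).space) :
    modularConj h (modularConj h v) = v := by
  induction v using induction_vec with
  | hp => exact isClosed_eq (by fun_prop) (by fun_prop)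
  | ih f => rw [modularConj_vec, modularConj_vec, starMap_starMap]

theorem norm_modularConj (h : IsTrace φ) (v : (biRep h).space) : ‖modularConj h v‖ = ‖v‖ := by
  induction v using induction_vec with
  | hp => exact isClosed_eq (by fun_prop) (by fun_prop)
  | ih f =>
    rw [modularConj_vec, ← sq_eq_sq₀ (norm_nonneg _) (norm_nonneg _), norm_vec_sq, norm_vec_sq,
      sqNorm, sqNorm, form_starMap h]

theorem modularConj_biRep (h : IsTrace φ) (g k : Γ) (v : (biRep h).space) :
    modularConj h ((biRep h).hom (g, k) v) = (biRep h).hom (k, g) (modularConj h v) := by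
  induction v using induction_vec with
  | hp =>
    exact isClosed_eq ((modularConj h).continuous.comp ((biRep h).hom (g, k)).continuous)
      (((biRep h).hom (k, g)).continuous.comp (modularConj h).continuous)
  | ih f => rw [biRep_hom_vec, modularConj_vec, modularConj_vec, biRep_hom_vec, starMap_biShift]

theorem modularConj_δ (h : IsTrace φ) (g : Γ) : modularConj h (δ h g) = δ h g⁻¹ := by
  rw [δ, modularConj_vec, starMap_single, map_one, δ]

/-- The right regular representation on the GNS space is the dual of the left one. -/
theorem isDualOf_gnsRep (h : IsTrace φ) :
    ((biRep h).comap (MonoidHom.inr Γ Γ)).IsDualOf (gnsRep φ h) := by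
  refine ⟨{ toLinearEquiv := LinearEquiv.ofInvolutive (modularConj h).toLinearMap
              (modularConj_modularConj h)
            norm_map' := norm_modularConj h }, fun g v => ?_⟩
  change modularConj h (GNS.translation h g v) = (biRep h).hom (1, g) (modularConj h v)
  exact (congrArg (modularConj h) (translation_eq_biTranslation h g v)).trans
    (modularConj_biRep h g 1 v)

/-! ### Conjugation-invariant vectors of a character -/

/-- A vector state of a trace given by a positive operator commuting with left translations and with
conjugations is again positive definite and conjugation-invariant. -/
theorem isTrace_of_isPositive (h : IsTrace φ) {T : (biRep h).space →L[ℂ] (biRep h).space}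
    (hT : T.IsPositive) (hl : ∀ g v, T ((biRep h).hom (g, 1) v) = (biRep h).hom (g, 1) (T v))
    (hc : ∀ g v, T ((biRep h).hom (g, g) v) = (biRep h).hom (g, g) (T v))
    (h1 : inner ℂ (δ h 1) (T (δ h 1)) = 1) :
    IsTrace fun g => inner ℂ (δ h 1) (T (δ h g)) := by
  have hinner : ∀ x y, inner ℂ (δ h 1) (T (δ h (x⁻¹ * y))) = inner ℂ (δ h x) (T (δ h y)) := by
    intro x y
    rw [← LinearIsometryEquiv.inner_map_map ((biRep h).hom (x, 1)), ← hl, biRep_hom_δ, biRep_hom_δ]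
    simp
  refine ⟨fun n γ α => ?_, fun γ x => ?_, h1⟩
  · convert hT.inner_nonneg_right (∑ i, α i • δ h (γ i)) using 1
    simp only [map_sum, map_smul, sum_inner, inner_sum, inner_smul_left, inner_smul_right, hinner,
      Finset.mul_sum]
    exact Finset.sum_congr rfl fun i _ => Finset.sum_congr rfl fun j _ => by ring
  · rw [← LinearIsometryEquiv.inner_map_map ((biRep h).hom (x, x)), ← hc, biRep_hom_δ, biRep_hom_δ]
    congr 3 <;> simp [mul_assoc]

theorem isPositive_one_add {H : Type*} [NormedAddCommGroup H] [InnerProductSpace ℂ H]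
    {S : H →L[ℂ] H} (hS : S.IsSymmetric) (hn : ‖S‖ ≤ 1) : (1 + S).IsPositive := by
  refine ⟨fun x y => ?_, fun x => ?_⟩
  · have := hS x y
    simp only [ContinuousLinearMap.coe_coe] at this
    simp [inner_add_left, inner_add_right, this]
  · have h1 : |RCLike.re (inner ℂ (S x) x)| ≤ ‖x‖ ^ 2 := by
      refine (RCLike.abs_re_le_norm _).trans ((norm_inner_le_norm _ _).trans ?_)
      rw [sq]
      gcongr
      exact (S.le_of_opNorm_le hn x).trans (one_mul _).le
    have h2 : (1 + S).reApplyInnerSelf x = ‖x‖ ^ 2 + RCLike.re (inner ℂ (S x) x) := by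
      rw [ContinuousLinearMap.reApplyInnerSelf_apply, add_apply, inner_add_left,
        map_add]
      congr 1
      exact inner_self_eq_norm_sq (𝕜 := ℂ) x
    rw [h2]
    linarith [neg_abs_le (RCLike.re (inner ℂ (S x) x))]

/-- Extremality of a character: an operator in the commutant of the left translations and of the
conjugations acts on the cyclic vector as a scalar. This is the self-adjoint case. -/
theorem exists_apply_δ_of_isSymmetric (h : IsTrace φ) (hφ : φ ∈ characters Γ)
    {T : (biRep h).space →L[ℂ] (biRep h).space} (hT : T.IsSymmetric)
    (hl : ∀ g v, T ((biRep h).hom (g, 1) v) = (biRep h).hom (g, 1) (T v))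
    (hc : ∀ g v, T ((biRep h).hom (g, g) v) = (biRep h).hom (g, g) (T v)) :
    ∃ a : ℂ, T (δ h 1) = a • δ h 1 := by
  set c : ℝ := RCLike.re (inner ℂ (δ h 1) (T (δ h 1))) with hcdef
  have hδ1 : inner ℂ (δ h 1) (δ h 1) = (1 : ℂ) := by rw [inner_δ]; simp [h.map_one]
  have hc' : (c : ℂ) = inner ℂ (δ h 1) (T (δ h 1)) := by
    have := hT.coe_re_inner_self_apply (δ h 1)
    exact this
  -- the operator is centred and scaled to a self-adjoint contraction `S`
  let S₀ : (biRep h).space →L[ℂ] (biRep h).space := T - (c : ℂ) • 1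
  let s : ℝ := (‖S₀‖ + 1)⁻¹
  have hs : 0 < s := by positivity
  let S : (biRep h).space →L[ℂ] (biRep h).space := (s : ℂ) • S₀
  have hSn : ‖S‖ ≤ 1 := by
    rw [norm_smul, Complex.norm_real, Real.norm_of_nonneg hs.le, inv_mul_le_one₀ (by positivity)]
    linarith
  have hSsym : S.IsSymmetric := by
    intro x y
    have h1 : inner ℂ (T x) y = inner ℂ x (T y) := hT x y
    change inner ℂ ((s : ℂ) • (T x - (c : ℂ) • x)) y = inner ℂ x ((s : ℂ) • (T y - (c : ℂ) • y))
    simp only [inner_sub_left, inner_sub_right, inner_smul_left, inner_smul_right, h1,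
      Complex.conj_ofReal]
  have hSl : ∀ g v, S ((biRep h).hom (g, 1) v) = (biRep h).hom (g, 1) (S v) := by
    intro g v
    change (s : ℂ) • (T ((biRep h).hom (g, 1) v) - (c : ℂ) • (biRep h).hom (g, 1) v) =
      (biRep h).hom (g, 1) ((s : ℂ) • (T v - (c : ℂ) • v))
    rw [hl, map_smul, map_sub, map_smul]
  have hSc : ∀ g v, S ((biRep h).hom (g, g) v) = (biRep h).hom (g, g) (S v) := by
    intro g v
    change (s : ℂ) • (T ((biRep h).hom (g, g) v) - (c : ℂ) • (biRep h).hom (g, g) v) =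
      (biRep h).hom (g, g) ((s : ℂ) • (T v - (c : ℂ) • v))
    rw [hc, map_smul, map_sub, map_smul]
  have hSδ : inner ℂ (δ h 1) (S (δ h 1)) = 0 := by
    change inner ℂ (δ h 1) ((s : ℂ) • (T (δ h 1) - (c : ℂ) • δ h 1)) = 0
    rw [inner_smul_right, inner_sub_right, inner_smul_right, hδ1, hc', mul_one, sub_self, mul_zero]
  have htr : ∀ S : (biRep h).space →L[ℂ] (biRep h).space, S.IsSymmetric → ‖S‖ ≤ 1 →
      (∀ g v, S ((biRep h).hom (g, 1) v) = (biRep h).hom (g, 1) (S v)) →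
      (∀ g v, S ((biRep h).hom (g, g) v) = (biRep h).hom (g, g) (S v)) →
      inner ℂ (δ h 1) (S (δ h 1)) = 0 →
      IsTrace fun g => inner ℂ (δ h 1) ((1 + S) (δ h g)) := fun S h1 h2 h3 h4 h5 =>
    isTrace_of_isPositive h (isPositive_one_add h1 h2) (fun g v => by simp [h3])
      (fun g v => by simp [h4]) (by
        rw [add_apply, inner_add_right, h5, add_zero]; exact hδ1)
  have hplus := htr S hSsym hSn hSl hSc hSδ
  have hminus := htr (-S) (fun x y => by
      have h1 : inner ℂ (S x) y = inner ℂ x (S y) := hSsym x y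
      simp [h1]) (by rwa [norm_neg])
    (fun g v => by simp [hSl]) (fun g v => by simp [hSc]) (by simp [hSδ])
  have hφg : ∀ g, φ g = inner ℂ (δ h 1) (δ h g) := fun g => by rw [inner_δ]; simp
  have heq := hφ.2 hplus hminus ⟨1 / 2, 1 / 2, by norm_num, by norm_num, by norm_num, by
    ext g
    simp [hφg g]
    ring⟩
  have hS0 : S (δ h 1) = 0 := by
    refine eq_zero_of_forall_inner_δ h fun g => ?_
    have h1 := congrFun heq g
    simp only [hφg g, add_apply, inner_add_right] at h1
    have h2 : inner ℂ (δ h 1) (S (δ h g)) = 0 := by simpa using h1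
    have h3 : inner ℂ (S (δ h 1)) (δ h g) = inner ℂ (δ h 1) (S (δ h g)) := hSsym _ _
    rw [← inner_conj_symm, h3, h2, map_zero]
  refine ⟨c, ?_⟩
  have h4 : (s : ℂ) • (T (δ h 1) - (c : ℂ) • δ h 1) = 0 := hS0
  rcases smul_eq_zero.1 h4 with h5 | h5
  · exact absurd (Complex.ofReal_eq_zero.1 h5) hs.ne'
  · exact sub_eq_zero.1 h5

/-- Extremality of a character: an operator in the commutant of the left translations and of the
conjugations acts on the cyclic vector as a scalar. -/
theorem exists_apply_δ (h : IsTrace φ) (hφ : φ ∈ characters Γ)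
    {T : (biRep h).space →L[ℂ] (biRep h).space}
    (hl : ∀ g v, T ((biRep h).hom (g, 1) v) = (biRep h).hom (g, 1) (T v))
    (hc : ∀ g v, T ((biRep h).hom (g, g) v) = (biRep h).hom (g, g) (T v)) :
    ∃ a : ℂ, T (δ h 1) = a • δ h 1 := by
  have hadj : ∀ p, (∀ v, T ((biRep h).hom p⁻¹ v) = (biRep h).hom p⁻¹ (T v)) →
      ∀ v, T.adjoint ((biRep h).hom p v) = (biRep h).hom p (T.adjoint v) := by
    intro p hp v
    refine ext_inner_right ℂ fun w => ?_
    rw [ContinuousLinearMap.adjoint_inner_left, inner_biRep_hom_left, inner_biRep_hom_left,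
      ContinuousLinearMap.adjoint_inner_left, hp]
  have hl' : ∀ g v, T.adjoint ((biRep h).hom (g, 1) v) = (biRep h).hom (g, 1) (T.adjoint v) :=
    fun g => hadj (g, 1) (by simpa using hl g⁻¹)
  have hc' : ∀ g v, T.adjoint ((biRep h).hom (g, g) v) = (biRep h).hom (g, g) (T.adjoint v) :=
    fun g => hadj (g, g) (by simpa using hc g⁻¹)
  obtain ⟨a, ha⟩ := exists_apply_δ_of_isSymmetric h hφ (T := T + T.adjoint)
    (fun x y => by
      simp [inner_add_left, inner_add_right, ContinuousLinearMap.adjoint_inner_left,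
        ContinuousLinearMap.adjoint_inner_right, add_comm])
    (fun g v => by simp [hl, hl']) (fun g v => by simp [hc, hc'])
  obtain ⟨b, hb⟩ := exists_apply_δ_of_isSymmetric h hφ (T := Complex.I • (T - T.adjoint))
    (fun x y => by
      simp [inner_sub_left, inner_sub_right, inner_smul_left, inner_smul_right,
        ContinuousLinearMap.adjoint_inner_left, ContinuousLinearMap.adjoint_inner_right]
      ring)
    (fun g v => by simp [hl, hl']) (fun g v => by simp [hc, hc'])
  refine ⟨2⁻¹ * (a - Complex.I * b), ?_⟩
  rw [mul_smul, sub_smul, mul_smul, ← ha, ← hb]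
  simp only [add_apply, smul_apply,
    sub_apply, smul_smul, Complex.I_mul_I, neg_smul, one_smul]
  module

/-- The action of `Γ × Γ` on two copies of the GNS space. -/
def pairAction (h : IsTrace φ) (p : Γ × Γ) :
    WithLp 2 ((biRep h).space × (biRep h).space) →L[ℂ]
      WithLp 2 ((biRep h).space × (biRep h).space) :=
  (WithLp.prodContinuousLinearEquiv 2 ℂ _ _).symm.toContinuousLinearMap ∘L
    (((biRep h).hom p).toContinuousLinearEquiv.toContinuousLinearMap.prodMap
      ((biRep h).hom p).toContinuousLinearEquiv.toContinuousLinearMap) ∘L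
    (WithLp.prodContinuousLinearEquiv 2 ℂ _ _).toContinuousLinearMap

theorem pairAction_toLp (h : IsTrace φ) (p : Γ × Γ) (x y : (biRep h).space) :
    pairAction h p (WithLp.toLp 2 (x, y)) =
      WithLp.toLp 2 ((biRep h).hom p x, (biRep h).hom p y) := rfl

theorem inner_pairAction_left (h : IsTrace φ) (p : Γ × Γ)
    (x y : WithLp 2 ((biRep h).space × (biRep h).space)) :
    inner ℂ (pairAction h p x) y = inner ℂ x (pairAction h p⁻¹ y) := by
  rw [WithLp.prod_inner_apply, WithLp.prod_inner_apply]
  exact congrArg₂ (· + ·) (inner_biRep_hom_left h p _ _) (inner_biRep_hom_left h p _ _)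

/-- The closure of the graph of the densely defined operator `x ↦ x v` on the GNS space, where `x`
runs through the group ring. -/
def mulGraph (h : IsTrace φ) (v : (biRep h).space) :
    Submodule ℂ (WithLp 2 ((biRep h).space × (biRep h).space)) :=
  (Submodule.span ℂ
    (Set.range fun g => WithLp.toLp 2 (δ h g, (biRep h).hom (g, 1) v))).topologicalClosure

theorem mem_mulGraph (h : IsTrace φ) (v : (biRep h).space) (g : Γ) :
    WithLp.toLp 2 (δ h g, (biRep h).hom (g, 1) v) ∈ mulGraph h v :=
  Submodule.le_topologicalClosure _ (Submodule.subset_span ⟨g, rfl⟩)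

instance (h : IsTrace φ) (v : (biRep h).space) : CompleteSpace (mulGraph h v) :=
  Submodule.topologicalClosure.completeSpace _

theorem pairAction_mem_mulGraph (h : IsTrace φ) {v : (biRep h).space} {p : Γ × Γ}
    (hp : ∀ g, pairAction h p (WithLp.toLp 2 (δ h g, (biRep h).hom (g, 1) v)) ∈ mulGraph h v)
    {w : WithLp 2 ((biRep h).space × (biRep h).space)} (hw : w ∈ mulGraph h v) :
    pairAction h p w ∈ mulGraph h v := by
  have h1 : mulGraph h v ≤ (mulGraph h v).comap (pairAction h p).toLinearMap := by
    refine Submodule.topologicalClosure_minimal _ (Submodule.span_le.2 ?_)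
      ((Submodule.isClosed_topologicalClosure _).preimage (pairAction h p).continuous)
    rintro _ ⟨g, rfl⟩
    exact hp g
  exact h1 hw

/-- The operator `x ↦ x v` is closable: moving `x` to the other side of the inner product with
`δ_g` shows that the second component of a point of the graph depends only on the first one. -/
theorem inner_δ_snd_of_mem_mulGraph (h : IsTrace φ) {v : (biRep h).space}
    {w : WithLp 2 ((biRep h).space × (biRep h).space)} (hw : w ∈ mulGraph h v) (g : Γ) :
    inner ℂ (δ h g) w.snd = inner ℂ ((biRep h).hom (1, g⁻¹) (modularConj h w.fst)) v := by
  refine closure_minimal (t := {w : WithLp 2 ((biRep h).space × (biRep h).space) |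
    inner ℂ (δ h g) w.snd = inner ℂ ((biRep h).hom (1, g⁻¹) (modularConj h w.fst)) v}) ?_ ?_ hw
  · intro w hw
    refine Submodule.span_induction (p := fun w _ => inner ℂ (δ h g) w.snd =
      inner ℂ ((biRep h).hom (1, g⁻¹) (modularConj h w.fst)) v) ?_ ?_ ?_ ?_ hw
    · rintro _ ⟨x, rfl⟩
      change inner ℂ (δ h g) ((biRep h).hom (x, 1) v) =
        inner ℂ ((biRep h).hom (1, g⁻¹) (modularConj h (δ h x))) v
      rw [modularConj_δ, biRep_hom_δ]
      have := inner_biRep_hom_left h (x, 1)⁻¹ (δ h g) v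
      rw [inv_inv, biRep_hom_δ] at this
      rw [← this]
      simp
    · simp
    · intro x y _ _ hx hy
      simp only [WithLp.add_fst, WithLp.add_snd, map_add, inner_add_left, inner_add_right, hx, hy]
    · intro c x _ hx
      simp only [WithLp.smul_fst, WithLp.smul_snd, map_smulₛₗ, RingHom.id_apply,
        inner_smul_left, inner_smul_right, hx, Complex.conj_conj]
  · have h1 : Continuous fun w : WithLp 2 ((biRep h).space × (biRep h).space) => w.snd :=
      (WithLp.sndL 2 ℂ _ _).continuous
    have h2 : Continuous fun w : WithLp 2 ((biRep h).space × (biRep h).space) => w.fst :=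
      (WithLp.fstL 2 ℂ _ _).continuous
    exact isClosed_eq (continuous_const.inner h1)
      ((((biRep h).hom (1, g⁻¹)).continuous.comp ((modularConj h).continuous.comp h2)).inner
        continuous_const)

/-- A character is a factor trace: its GNS space has no conjugation-invariant vectors besides the
multiples of the cyclic vector. For an invariant vector `v`, the projection onto the graph of
`x ↦ x v` has matrix entries in the commutant of the left translations and of the conjugations, so
it maps `(δ, 0)` to a point `(a δ, b δ)` of the graph. -/
theorem exists_eq_smul_δ (h : IsTrace φ) (hφ : φ ∈ characters Γ) {v : (biRep h).space}
    (hv : ∀ g, (biRep h).hom (g, g) v = v) : ∃ a : ℂ, v = a • δ h 1 := by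
  let incl : (biRep h).space →L[ℂ] WithLp 2 ((biRep h).space × (biRep h).space) :=
    (WithLp.prodContinuousLinearEquiv 2 ℂ _ _).symm.toContinuousLinearMap ∘L
      ContinuousLinearMap.inl ℂ _ _
  let P : (biRep h).space →L[ℂ] WithLp 2 ((biRep h).space × (biRep h).space) :=
    (mulGraph h v).starProjection ∘L incl
  have hcomm : ∀ p : Γ × Γ, (∀ w ∈ mulGraph h v, pairAction h p w ∈ mulGraph h v) →
      (∀ w ∈ mulGraph h v, pairAction h p⁻¹ w ∈ mulGraph h v) →
      ∀ x, P ((biRep h).hom p x) = pairAction h p (P x) := by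
    intro p hp hp' x
    refine Submodule.eq_starProjection_of_mem_orthogonal
      (hp _ (Submodule.starProjection_apply_mem _ _)) ?_
    have h1 : incl ((biRep h).hom p x) = pairAction h p (incl x) := by
      change WithLp.toLp 2 ((biRep h).hom p x, 0) =
        WithLp.toLp 2 ((biRep h).hom p x, (biRep h).hom p 0)
      rw [map_zero]
    have h2 : incl ((biRep h).hom p x) - pairAction h p (P x) =
        pairAction h p (incl x - P x) := by rw [h1, map_sub]
    refine (Submodule.mem_orthogonal' _ _).2 ?_
    change ∀ w ∈ mulGraph h v,
      inner ℂ (incl ((biRep h).hom p x) - pairAction h p (P x)) w = 0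
    rw [h2]
    intro w hw
    rw [inner_pairAction_left]
    exact (Submodule.mem_orthogonal' _ _).1
      (Submodule.sub_starProjection_mem_orthogonal (K := mulGraph h v) (incl x)) _ (hp' w hw)
  have hleft : ∀ g, ∀ w ∈ mulGraph h v, pairAction h (g, 1) w ∈ mulGraph h v := by
    intro g w hw
    refine pairAction_mem_mulGraph h (fun x => ?_) hw
    rw [pairAction_toLp, biRep_hom_δ, biRep_hom_hom]
    simpa using mem_mulGraph h v (g * x)
  have hconj : ∀ g, ∀ w ∈ mulGraph h v, pairAction h (g, g) w ∈ mulGraph h v := by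
    intro g w hw
    refine pairAction_mem_mulGraph h (fun x => ?_) hw
    have h1 : (biRep h).hom (g, g) ((biRep h).hom (x, 1) v) =
        (biRep h).hom (g * x * g⁻¹, 1) v := by
      conv_rhs => rw [← hv g]
      rw [biRep_hom_hom, biRep_hom_hom]
      simp
    rw [pairAction_toLp, biRep_hom_δ, h1]
    exact mem_mulGraph h v _
  have hPl : ∀ g x, P ((biRep h).hom (g, 1) x) = pairAction h (g, 1) (P x) := fun g =>
    hcomm _ (hleft g) (by simpa using hleft g⁻¹)
  have hPc : ∀ g x, P ((biRep h).hom (g, g) x) = pairAction h (g, g) (P x) := fun g =>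
    hcomm _ (hconj g) (by simpa using hconj g⁻¹)
  obtain ⟨a, ha⟩ := exists_apply_δ h hφ (T := WithLp.fstL 2 ℂ _ _ ∘L P)
    (fun g x => congrArg WithLp.fst (hPl g x)) (fun g x => congrArg WithLp.fst (hPc g x))
  obtain ⟨b, hb⟩ := exists_apply_δ h hφ (T := WithLp.sndL 2 ℂ _ _ ∘L P)
    (fun g x => congrArg WithLp.snd (hPl g x)) (fun g x => congrArg WithLp.snd (hPc g x))
  have ha' : (P (δ h 1)).fst = a • δ h 1 := ha
  have hb' : (P (δ h 1)).snd = b • δ h 1 := hb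
  have hPmem : P (δ h 1) ∈ mulGraph h v := Submodule.starProjection_apply_mem _ _
  have h1mem : WithLp.toLp 2 (δ h 1, v) ∈ mulGraph h v := by
    have h1 := mem_mulGraph h v 1
    rwa [hv 1] at h1
  -- both `(a δ, b δ)` and `(a δ, a v)` lie on the graph, so closability gives `b δ = a v`
  have hab : b • δ h 1 - a • v = 0 := by
    have hmem := (mulGraph h v).sub_mem hPmem ((mulGraph h v).smul_mem a h1mem)
    refine eq_zero_of_forall_inner_δ h fun g => ?_
    have h2 := inner_δ_snd_of_mem_mulGraph h hmem g
    simpa [ha', hb'] using h2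
  -- if `a = 0`, the projection kills `(δ, 0)`, which is not orthogonal to the point `(δ, v)`
  have ha0 : a ≠ 0 := by
    rintro rfl
    rw [zero_smul, sub_zero] at hab
    have hP0 : P (δ h 1) = 0 := by
      apply WithLp.ofLp_injective
      exact Prod.ext (ha'.trans (zero_smul _ _)) (hb'.trans hab)
    have horth := Submodule.sub_starProjection_mem_orthogonal (K := mulGraph h v) (incl (δ h 1))
    have h3 : inner ℂ (WithLp.toLp 2 (δ h 1, v)) (incl (δ h 1) - P (δ h 1)) = 0 :=
      (Submodule.mem_orthogonal _ _).1 horth _ h1mem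
    rw [hP0, sub_zero, WithLp.prod_inner_apply] at h3
    have h4 : inner ℂ (δ h 1) (δ h 1) + inner ℂ v (0 : (biRep h).space) = 0 := h3
    rw [inner_zero_right, inner_δ] at h4
    simp [h.map_one] at h4
  refine ⟨a⁻¹ * b, ?_⟩
  rw [mul_smul, sub_eq_zero.1 hab, inv_smul_smul₀ ha0]

/-! ### Kazhdan pairs -/

/-- `(Q, ε)` is a Kazhdan pair for the representations in `R`: no nonzero vector orthogonal to the
invariant vectors is `(Q, ε)`-invariant. -/
def IsKazhdanPair (R : Set (UnitaryRep Γ)) (Q : Finset Γ) (ε : ℝ) : Prop :=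
  0 < ε ∧ ∀ π ∈ R, ∀ ξ ∈ π.invariantsᗮ, (∀ g ∈ Q, ‖π.hom g ξ - ξ‖ < ε * ‖ξ‖) → ξ = 0

theorem eq_zero_of_mem_withoutInvariants (π : UnitaryRep Γ) (η : π.withoutInvariants.space)
    (hη : ∀ g, π.withoutInvariants.hom g η = η) : η = 0 := by
  have h1 : (η : π.invariantsᗮ).1 ∈ π.invariants := fun g => congrArg Subtype.val (hη g)
  exact Subtype.ext (inner_self_eq_zero.1 ((Submodule.mem_orthogonal _ _).1 η.2 _ h1))

theorem exists_isKazhdanPair_of_hasPropertyT (hT : HasPropertyT Γ) :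
    ∃ (Q : Finset Γ) (ε : ℝ), IsKazhdanPair (Set.univ : Set (UnitaryRep Γ)) Q ε := by
  obtain ⟨Q, ε, hε, h⟩ := hT
  refine ⟨Q, ε, hε, fun π _ ξ hξ hQ => ?_⟩
  by_contra hne
  obtain ⟨η, hη0, hη⟩ := h π.withoutInvariants
    ⟨⟨ξ, hξ⟩, fun h0 => hne (congrArg Subtype.val h0), hQ⟩
  exact hη0 (eq_zero_of_mem_withoutInvariants π η hη)

/-- A Fell neighbourhood of the trivial representation contains every representation having a
function of positive type which is uniformly close to `1` on a suitable finite set. -/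
theorem exists_finset_of_isOpen {U : Set (UnitaryRep Γ)} (hU : IsOpen U)
    (h1 : UnitaryRep.trivial Γ ∈ U) : ∃ (Q : Finset Γ) (ε : ℝ), 0 < ε ∧ ∀ ρ : UnitaryRep Γ,
      (∃ η : ρ.space, ∀ g ∈ Q, ‖1 - inner ℂ η (ρ.hom g η)‖ < ε) → ρ ∈ U := by
  classical
  induction hU with
  | basic U hU =>
    obtain ⟨π, ξ, Q, ε, hε, rfl⟩ := hU
    obtain ⟨n, η, hη⟩ := h1
    -- at the trivial representation the sum of functions of positive type is a constant `c ≥ 0`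
    let c : ℝ := ∑ k, ‖η k‖ ^ 2
    have hc : 0 ≤ c := by positivity
    have hsum : ∀ g, ∑ k, inner ℂ (η k) ((UnitaryRep.trivial Γ).hom g (η k)) = (c : ℂ) := by
      intro g
      change _ = ((∑ k, ‖η k‖ ^ 2 : ℝ) : ℂ)
      push_cast
      exact Finset.sum_congr rfl fun k _ => inner_self_eq_norm_sq_to_K (𝕜 := ℂ) (η k)
    simp only [hsum] at hη
    have hev : ∀ᶠ r : ℝ in nhdsWithin 0 (Set.Ioi 0), ∀ g ∈ Q,
        ‖inner ℂ ξ (π.hom g ξ) - c‖ + c * r < ε := by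
      rw [Filter.eventually_all_finset]
      intro g hg
      have hlim : Filter.Tendsto (fun r : ℝ => ‖inner ℂ ξ (π.hom g ξ) - c‖ + c * r)
          (nhdsWithin 0 (Set.Ioi 0)) (nhds (‖inner ℂ ξ (π.hom g ξ) - c‖ + c * 0)) :=
        (Continuous.tendsto (by fun_prop) 0).mono_left nhdsWithin_le_nhds
      exact hlim.eventually_lt_const (by simpa using hη g hg)
    obtain ⟨r, hr, hr0⟩ := (hev.and self_mem_nhdsWithin).exists
    refine ⟨Q, r, hr0, fun ρ ⟨ζ, hζ⟩ => ⟨1, fun _ => ((√c : ℝ) : ℂ) • ζ, fun g hg => ?_⟩⟩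
    have h2 : ∑ _k : Fin 1, inner ℂ (((√c : ℝ) : ℂ) • ζ) (ρ.hom g (((√c : ℝ) : ℂ) • ζ)) =
        (c : ℂ) * inner ℂ ζ (ρ.hom g ζ) := by
      rw [Fin.sum_univ_one, map_smul, inner_smul_left, inner_smul_right, ← mul_assoc,
        Complex.conj_ofReal, ← Complex.ofReal_mul, Real.mul_self_sqrt hc]
    rw [h2]
    calc ‖inner ℂ ξ (π.hom g ξ) - c * inner ℂ ζ (ρ.hom g ζ)‖
        = ‖(inner ℂ ξ (π.hom g ξ) - c) + c * (1 - inner ℂ ζ (ρ.hom g ζ))‖ := by ring_nf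
      _ ≤ ‖inner ℂ ξ (π.hom g ξ) - c‖ + c * ‖1 - inner ℂ ζ (ρ.hom g ζ)‖ := by
          refine (norm_add_le _ _).trans_eq ?_
          rw [norm_mul, Complex.norm_real, Real.norm_of_nonneg hc]
      _ ≤ ‖inner ℂ ξ (π.hom g ξ) - c‖ + c * r := by gcongr; exact (hζ g hg).le
      _ < ε := hr g hg
  | univ => exact ⟨∅, 1, one_pos, fun _ _ => trivial⟩
  | inter U V _ _ ihU ihV =>
    obtain ⟨Q, ε, hε, hQ⟩ := ihU h1.1
    obtain ⟨Q', ε', hε', hQ'⟩ := ihV h1.2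
    refine ⟨Q ∪ Q', min ε ε', lt_min hε hε', fun ρ ⟨η, hη⟩ => ⟨hQ ρ ⟨η, fun g hg => ?_⟩,
      hQ' ρ ⟨η, fun g hg => ?_⟩⟩⟩
    · exact (hη g (Finset.mem_union_left _ hg)).trans_le (min_le_left _ _)
    · exact (hη g (Finset.mem_union_right _ hg)).trans_le (min_le_right _ _)
  | sUnion S _ ih =>
    obtain ⟨U, hUS, hU⟩ := h1
    obtain ⟨Q, ε, hε, hQ⟩ := ih U hUS hU
    exact ⟨Q, ε, hε, fun ρ hρ => ⟨U, hUS, hQ ρ hρ⟩⟩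

theorem exists_isKazhdanPair_of_hasPropertyTRel {R : Set (UnitaryRep Γ)}
    (hT : HasPropertyTRel R) : ∃ (Q : Finset Γ) (ε : ℝ), IsKazhdanPair R Q ε := by
  obtain ⟨U, hU, h1, hR⟩ := hT
  obtain ⟨Q, ε, hε, hQ⟩ := exists_finset_of_isOpen hU h1
  refine ⟨Q, ε, hε, fun π hπ ξ hξ hinv => ?_⟩
  by_contra hne
  have hn : 0 < ‖ξ‖ := norm_pos_iff.2 hne
  let ζ : π.withoutInvariants.space := ((‖ξ‖⁻¹ : ℝ) : ℂ) • (⟨ξ, hξ⟩ : π.invariantsᗮ)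
  have hζ : ‖ζ‖ = 1 := by
    change ‖((‖ξ‖⁻¹ : ℝ) : ℂ) • ξ‖ = 1
    rw [norm_smul, Complex.norm_real, norm_inv, norm_norm, inv_mul_cancel₀ hn.ne']
  have hmem : π.withoutInvariants ∈ U := by
    refine hQ _ ⟨ζ, fun g hg => ?_⟩
    have h2 : (1 : ℂ) = inner ℂ ζ ζ := by
      rw [inner_self_eq_norm_sq_to_K, hζ]; simp
    rw [h2, ← inner_sub_right]
    refine (norm_inner_le_norm _ _).trans_lt ?_
    rw [hζ, one_mul, norm_sub_rev]
    change ‖π.hom g (((‖ξ‖⁻¹ : ℝ) : ℂ) • ξ) - ((‖ξ‖⁻¹ : ℝ) : ℂ) • ξ‖ < ε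
    rw [map_smul, ← smul_sub, norm_smul, Complex.norm_real, norm_inv, norm_norm,
      inv_mul_lt_iff₀ hn, mul_comm]
    exact hinv g hg
  obtain ⟨T, hT⟩ := hR π hπ hmem
  -- a representation equivalent to the trivial one consists of invariant vectors
  have hζ0 : ζ = 0 := eq_zero_of_mem_withoutInvariants π ζ fun g =>
    T.injective ((hT g ζ).trans rfl)
  rw [hζ0, norm_zero] at hζ
  exact zero_ne_one hζ

/-! ### Averaging over conjugations -/

/-- If some `g ∈ Q` moves `w` by at least `ε ‖w‖`, the parallelogram law bounds the sum of `w` and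
its translates by the elements of `Q`. -/
theorem norm_add_sum_le (π : UnitaryRep Γ) {Q : Finset Γ} {ε : ℝ} {w : π.space} {g : Γ}
    (hg : g ∈ Q) (hw : ε * ‖w‖ ≤ ‖π.hom g w - w‖) (hε : 0 < ε) :
    ‖w + ∑ k ∈ Q, π.hom k w‖ ≤ (√(4 - ε ^ 2) + (Q.card - 1)) * ‖w‖ := by
  classical
  have h1 : ‖w + π.hom g w‖ ≤ √(4 - ε ^ 2) * ‖w‖ := by
    have hpar := parallelogram_law_with_norm ℂ (π.hom g w) w
    rw [LinearIsometryEquiv.norm_map, add_comm (π.hom g w) w] at hpar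
    have h2 : (ε * ‖w‖) ^ 2 ≤ ‖π.hom g w - w‖ ^ 2 := by gcongr
    rw [← Real.sqrt_sq (norm_nonneg w), ← Real.sqrt_mul' _ (sq_nonneg _)]
    refine Real.le_sqrt_of_sq_le ?_
    nlinarith
  have h3 : ‖∑ k ∈ Q.erase g, π.hom k w‖ ≤ (Q.card - 1) * ‖w‖ := by
    refine (norm_sum_le _ _).trans_eq ?_
    simp only [LinearIsometryEquiv.norm_map, Finset.sum_const, nsmul_eq_mul,
      Finset.card_erase_of_mem hg]
    rw [Nat.cast_pred (Finset.card_pos.2 ⟨g, hg⟩)]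
  rw [← Finset.add_sum_erase Q (fun k => π.hom k w) hg, ← add_assoc, add_mul]
  exact (norm_add_le _ _).trans (add_le_add h1 h3)

/-- The average of the conjugates of an element of the group ring by the identity and by the
elements of `Q`. -/
def conjAverage (Q : Finset Γ) : (Γ →₀ ℂ) →ₗ[ℂ] (Γ →₀ ℂ) :=
  ((Q.card : ℂ) + 1)⁻¹ • (LinearMap.id + ∑ g ∈ Q, (biShift (g, g)).toLinearMap)

theorem conjAverage_apply (Q : Finset Γ) (f : Γ →₀ ℂ) :
    conjAverage Q f = ((Q.card : ℂ) + 1)⁻¹ • (f + ∑ g ∈ Q, biShift (g, g) f) := by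
  simp [conjAverage]

theorem ev_conjAverage (h : IsTrace φ) (Q : Finset Γ) (f : Γ →₀ ℂ) :
    ev φ (conjAverage Q f) = ev φ f := by
  rw [conjAverage_apply, map_smul, map_add, map_sum]
  simp only [ev_biShift_diag h, Finset.sum_const, nsmul_eq_mul, smul_eq_mul]
  field_simp [Nat.cast_add_one_ne_zero (R := ℂ) Q.card]
  ring

theorem conjAverage_unit (Q : Finset Γ) : conjAverage Q unit = unit := by
  rw [conjAverage_apply]
  have : ∀ g : Γ, biShift (g, g) (unit : Γ →₀ ℂ) = unit := fun g => by
    rw [unit, biShift_single]; simp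
  simp only [this, Finset.sum_const]
  have hsum : (unit : Γ →₀ ℂ) + Q.card • unit = ((Q.card : ℂ) + 1) • unit := by
    rw [add_smul, one_smul, Nat.cast_smul_eq_nsmul, add_comm]
  rw [hsum, inv_smul_smul₀ (Nat.cast_add_one_ne_zero Q.card)]

/-- Averaging over conjugations contracts the orthogonal complement of the constants in the GNS
space of a character whose representation of conjugations has the Kazhdan pair `(Q, ε)`. The factor
comes from `norm_add_sum_le`; the maximum with `0` covers the case `Q = ∅`. -/
theorem norm_vec_conjAverage_le (h : IsTrace φ) (hφ : φ ∈ characters Γ)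
    {R : Set (UnitaryRep Γ)} {Q : Finset Γ} {ε : ℝ} (hQ : IsKazhdanPair R Q ε)
    (hR : (biRep h).comap ((MonoidHom.id Γ).prod (MonoidHom.id Γ)) ∈ R) {f : Γ →₀ ℂ}
    (hf : ev φ f = 0) : ‖vec h (conjAverage Q f)‖ ≤
      max 0 ((√(4 - ε ^ 2) + (Q.card - 1)) / (Q.card + 1)) * ‖vec h f‖ := by
  let π := (biRep h).comap ((MonoidHom.id Γ).prod (MonoidHom.id Γ))
  have hsum : vec h (conjAverage Q f) =
      ((Q.card : ℂ) + 1)⁻¹ • (vec h f + ∑ g ∈ Q, (biRep h).hom (g, g) (vec h f)) := by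
    have hs : ∀ S : Finset Γ, vec h (∑ g ∈ S, biShift (g, g) f) =
        ∑ g ∈ S, (biRep h).hom (g, g) (vec h f) := fun S => by
      classical
      induction S using Finset.induction_on with
      | empty => exact norm_eq_zero.1 (by
          rw [← sq_eq_zero_iff, norm_vec_sq]; simp [sqNorm, GNS.form])
      | insert a S ha ih => rw [Finset.sum_insert ha, Finset.sum_insert ha, vec_add, ih,
          biRep_hom_vec]
    rw [conjAverage_apply, vec_smul, vec_add, hs]
  by_cases h0 : vec h f = 0
  · rw [hsum, h0]; simp
  have hinner : ∀ v, (∀ g, (biRep h).hom (g, g) v = v) → inner ℂ v (vec h f) = 0 := by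
    intro v hv
    obtain ⟨a, rfl⟩ := exists_eq_smul_δ h hφ hv
    have h1 : inner ℂ (δ h 1) (vec h f) = ev φ f := by
      rw [δ, inner_vec, ← form_unit_left]; rfl
    rw [inner_smul_left, h1, hf, mul_zero]
  have hperp : (show π.space from vec h f) ∈ π.invariantsᗮ :=
    (Submodule.mem_orthogonal _ _).2 hinner
  obtain ⟨g, hg, hge⟩ : ∃ g ∈ Q, ε * ‖vec h f‖ ≤ ‖(biRep h).hom (g, g) (vec h f) - vec h f‖ := by
    by_contra! hlt
    exact h0 (hQ.2 π hR _ hperp hlt)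
  have h2 : ‖vec h f + ∑ g ∈ Q, (biRep h).hom (g, g) (vec h f)‖ ≤
      (√(4 - ε ^ 2) + (Q.card - 1)) * ‖vec h f‖ :=
    norm_add_sum_le π (w := vec h f) hg hge hQ.1
  have hcard : ‖((Q.card : ℂ) + 1)⁻¹‖ = ((Q.card : ℝ) + 1)⁻¹ := by
    rw [norm_inv]
    congr 1
    rw [← Nat.cast_succ, Complex.norm_natCast, Nat.cast_succ]
  rw [hsum, norm_smul, hcard]
  calc ((Q.card : ℝ) + 1)⁻¹ * ‖vec h f + ∑ g ∈ Q, (biRep h).hom (g, g) (vec h f)‖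
      ≤ ((Q.card : ℝ) + 1)⁻¹ * ((√(4 - ε ^ 2) + (Q.card - 1)) * ‖vec h f‖) := by
        gcongr
    _ = (√(4 - ε ^ 2) + (Q.card - 1)) / (Q.card + 1) * ‖vec h f‖ := by ring
    _ ≤ _ := by gcongr; exact le_max_right _ _

/-- The characters in `R` are uniformly centred when `R` is hereditary and has a Kazhdan pair: the
conjugation representation on the GNS space is the restriction of the bi-regular representation to
the diagonal, so it belongs to `R`, and iterated averages of `f` converge to the constant `χ(f)` at
a rate independent of the character `χ`. -/
theorem isUniformlyCentred_charactersIn {R : Set (UnitaryRep Γ)}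
    (hR : UnitaryRep.IsHereditary R) {Q : Finset Γ} {ε : ℝ} (hQ : IsKazhdanPair R Q ε) :
    IsUniformlyCentred (charactersIn R) := by
  intro f η hη
  set ρ : ℝ := max 0 ((√(4 - ε ^ 2) + (Q.card - 1)) / (Q.card + 1)) with hρ
  have hρ0 : 0 ≤ ρ := le_max_left _ _
  have hρ1 : ρ < 1 := by
    refine max_lt one_pos ?_
    rw [div_lt_one (by positivity)]
    have : √(4 - ε ^ 2) < 2 := by
      rw [Real.sqrt_lt' two_pos]
      nlinarith [hQ.1]
    linarith
  obtain ⟨B, hB⟩ := (isCompact_traces (Γ := Γ)).exists_bound_of_continuousOn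
    (continuous_sqNorm f).continuousOn
  have hlim : Filter.Tendsto (fun n : ℕ => (ρ ^ 2) ^ n * B) Filter.atTop (nhds (0 * B)) :=
    (tendsto_pow_atTop_nhds_zero_of_lt_one (by positivity) (by nlinarith)).mul_const B
  rw [zero_mul] at hlim
  obtain ⟨n, hn⟩ := (hlim.eventually_lt_const hη).exists
  have hev : ∀ ψ, IsTrace ψ → ∀ n, ev ψ ((conjAverage Q)^[n] f) = ev ψ f := by
    intro ψ hψ n
    induction n with
    | zero => rfl
    | succ n ih => rw [Function.iterate_succ_apply', ev_conjAverage hψ, ih]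
  refine ⟨(conjAverage Q)^[n] f, fun ψ hψ => hev ψ hψ n, ?_⟩
  rintro χ ⟨hχ, h, hmem⟩
  have hdiag := hR.diagonal_closed (biRep h)
    (hR.subrep_closed _ hmem _ (isContainedIn_gnsRep h))
    (hR.dual_closed _ hmem _ (isDualOf_gnsRep h))
  have hcontr : ∀ n, ‖vec h ((conjAverage Q)^[n] f - ev χ f • unit)‖ ≤
      ρ ^ n * ‖vec h (f - ev χ f • unit)‖ := by
    intro n
    induction n with
    | zero => simp
    | succ n ih =>
      have h1 : (conjAverage Q)^[n + 1] f - ev χ f • unit =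
          conjAverage Q ((conjAverage Q)^[n] f - ev χ f • unit) := by
        rw [Function.iterate_succ_apply', map_sub, map_smul, conjAverage_unit]
      have h2 : ev χ ((conjAverage Q)^[n] f - ev χ f • unit) = 0 := by
        rw [map_sub, map_smul, hev χ h, ev_unit h, smul_eq_mul, mul_one, sub_self]
      rw [h1, pow_succ', mul_assoc]
      exact (norm_vec_conjAverage_le h hχ hQ hdiag h2).trans (by gcongr)
  have h3 := sqNorm_sub_ev h ((conjAverage Q)^[n] f)
  have h4 := sqNorm_sub_ev h f
  rw [hev χ h] at h3
  have h5 : sqNorm χ ((conjAverage Q)^[n] f - ev χ f • unit) ≤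
      (ρ ^ 2) ^ n * sqNorm χ (f - ev χ f • unit) := by
    rw [← norm_vec_sq h, ← norm_vec_sq h, pow_right_comm, ← mul_pow]
    gcongr
    exact hcontr n
  have h6 : sqNorm χ (f - ev χ f • unit) ≤ B := by
    have h7 := hB χ h
    rw [Real.norm_of_nonneg (sqNorm_nonneg h f)] at h7
    nlinarith [sq_nonneg ‖ev χ f‖]
  have h8 : (ρ ^ 2) ^ n * sqNorm χ (f - ev χ f • unit) ≤ (ρ ^ 2) ^ n * B := by gcongr
  linarith

theorem charactersIn_subset_traces (R : Set (UnitaryRep Γ)) : charactersIn R ⊆ traces Γ :=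
  fun _ hφ => hφ.1.1

theorem charactersIn_univ : charactersIn (Set.univ : Set (UnitaryRep Γ)) = characters Γ :=
  Set.Subset.antisymm (fun _ hφ => hφ.1) fun _ hφ => ⟨hφ, hφ.1, trivial⟩

theorem isHereditary_univ : UnitaryRep.IsHereditary (Set.univ : Set (UnitaryRep Γ)) :=
  ⟨fun _ _ _ _ => trivial, fun _ _ _ _ => trivial, fun _ _ _ => trivial⟩

end Kazhdan

end GroupTrace

end

theorem mainTheorem4 {Γ : Type u} [Group Γ] [Countable Γ] :
    (∀ R : Set (UnitaryRep Γ), UnitaryRep.IsHereditary R → HasPropertyTRel R →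
      closure (charactersIn R) ⊆ characters Γ ∧
      IsClosedFace (traces Γ) (closure (convexHull ℝ (charactersIn R))) ∧
      IsBauerSimplex (closure (convexHull ℝ (charactersIn R)))) ∧
    (HasPropertyT Γ → IsBauerSimplex (traces Γ)) := by
  refine ⟨fun R hR hT => ?_, fun hT => ?_⟩
  · obtain ⟨Q, ε, hQ⟩ := GroupTrace.exists_isKazhdanPair_of_hasPropertyTRel hT
    exact (GroupTrace.isUniformlyCentred_charactersIn hR hQ).isClosedFace_and_isBauerSimplex
      (GroupTrace.charactersIn_subset_traces R)
  · -- for a group with property (T), all representations are admitted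
    obtain ⟨Q, ε, hQ⟩ := GroupTrace.exists_isKazhdanPair_of_hasPropertyT hT
    have h1 := (GroupTrace.isUniformlyCentred_charactersIn GroupTrace.isHereditary_univ
      hQ).isClosedFace_and_isBauerSimplex (GroupTrace.charactersIn_subset_traces _)
    have h2 : closure (convexHull ℝ (characters Γ)) = traces Γ :=
      closure_convexHull_extremePoints GroupTrace.isCompact_traces GroupTrace.convex_traces
    rw [GroupTrace.charactersIn_univ, h2] at h1
    exact h1.2.2
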